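/- Let $D\ge 1$, let $\mathcal Z=\mathcal S^{D-1}\subset\mathbb R^D$ be the unit sphere, let $\kappa_{\rm pos}>0$, and write $\mathrm{vMF}(m,k)$ for the von Mises–Fisher distribution on $\mathcal Z$, whose density with respect to the surface measure is proportional to $z\mapsto e^{k\,m^\top z}$. Let $\mathcal X$ be a measurable space (also carrying a topology, which is used only in (iii)) and let $P(x|z)$ be a likelihood, i.e. a Markov kernel from $\mathcal Z$ to $\mathcal X$. The data are generated as follows: $z\sim\mathrm{Unif}(\mathcal Z)$, $z^+\sim\mathrm{vMF}(z,\kappa_{\rm pos})$ given $z$, and, independently, $z^-_1,\dots,z^-_M\sim\mathrm{Unif}(\mathcal Z)$ i.i.d.; given the latents, the observations $x\sim P(\cdot|z)$, $x^+\sim P(\cdot|z^+)$, $x^-_m\sim P(\cdot|z^-_m)$ are drawn independently. Let $P$ be the resulting law of $x$, and suppose that the posteriors are $P(z|x)=\mathrm{vMF}(\mu(x),\kappa(x))$ with measurable $\mu:\mathcal X\to\mathcal Z$, $\kappa:\mathcal X\to\mathbb R_{>0}$. An encoder is a pair $f=(\hat\mu,\hat\kappa)$ of measurable maps $\hat\mu:\mathcal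 X\to\mathcal Z$, $\hat\kappa:\mathcal X\to\mathbb R_{>0}$; it predicts $Q(\cdot|x)=\mathrm{vMF}(\hat\mu(x),\hat\kappa(x))$. Its MCInfoNCE loss with $M$ negatives is $$\mathcal L_M(f)=\mathbb E_{x,x^+,x^-_1,\dots,x^-_M}\left[-\log \mathbb E\left(\frac{e^{\kappa_{\rm pos}z^\top z^+}}{\frac1M e^{\kappa_{\rm pos}z^\top z^+}+\frac1M\sum_{m=1}^M e^{\kappa_{\rm pos}z^\top z^-_m}}\right)\right],$$ where the inner expectation is over independent $z\sim Q(\cdot|x)$, $z^+\sim Q(\cdot|x^+)$, $z_m^-\sim Q(\cdot|x_m^-)$. Let $\mathcal F$ be any class of encoders, each with uniform aggregate marginal $\int Q(\cdot|x)\,dP(x)=\mathrm{Unif}(\mathcal Z)$, that contains the true parameters $(\mu,\kappa)$ (for example all encoders with uniform aggregate marginal or, if $\mu$ and $\kappa$ are continuous, all continuous ones). Then $\mathcal L_\infty(f)=\lim_{M\to\infty}\mathcal L_M(f)$ exists for every $f\in\mathcal F$, the true parameters $(\mu,\kappa)$ minimize $\mathcal L_\infty$ over $\mathcal F$, and for every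 minimizer $f=(\hat\mu,\hat\kappa)$ of $\mathcal L_\infty$ over $\mathcal F$ there is one orthogonal matrix $R\in\mathbb R^{D\times D}$ such that $$\hat\mu(x)=R\,\mu(x)\quad\text{and}\quad\hat\kappa(x)=\kappa(x)$$ (i) for $P$-almost every $x$; (ii) for every $x$ with $P(\{x\})>0$; (iii) for every $x$ in the support of $P$ (all neighbourhoods of $x$ have positive $P$-measure) at which $\mu,\kappa,\hat\mu,\hat\kappa$ are continuous. -/

import Mathlib

open MeasureTheory ProbabilityTheory Filter
open scoped Topology RealInnerProductSpace

noncomputable section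

namespace MCInfoNCE

/-- The latent space: the unit sphere of `D`-dimensional Euclidean space. -/
abbrev Latent (D : ℕ) : Type := Metric.sphere (0 : EuclideanSpace ℝ (Fin D)) 1

/-- The surface measure on the latent sphere. -/
def surface (D : ℕ) : Measure (Latent D) :=
  (volume : Measure (EuclideanSpace ℝ (Fin D))).toSphere

instance (D : ℕ) : IsFiniteMeasure (surface D) := by
  unfold surface; infer_instance

/-- The uniform distribution on the latent sphere. -/
def unif (D : ℕ) : Measure (Latent D) := (surface D Set.univ)⁻¹ • surface D

/-- The inner product of two latents. -/
def dot {D : ℕ} (z w : Latent D) : ℝ :=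
  ⟪(z : EuclideanSpace ℝ (Fin D)), (w : EuclideanSpace ℝ (Fin D))⟫

/-- The von Mises-Fisher distribution with location `m` and concentration `k`: its density with
respect to the surface measure is proportional to `z ↦ exp (k * ⟨m, z⟩)`. -/
def vMF {D : ℕ} (m : Latent D) (k : ℝ) : Measure (Latent D) :=
  (surface D).tilted (fun z => k * dot m z)

lemma measurable_vMF (D : ℕ) :
    Measurable (fun p : Latent D × ℝ => vMF p.1 p.2) := by
  have hc : Continuous (fun q : (Latent D × ℝ) × Latent D =>
      Real.exp (q.1.2 * dot q.1.1 q.2)) := by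
    unfold dot; fun_prop
  have hi : Measurable (fun p : Latent D × ℝ =>
      ∫ z, Real.exp (p.2 * dot p.1 z) ∂(surface D)) :=
    (hc.stronglyMeasurable.integral_prod_right (ν := surface D)).measurable
  refine Measure.measurable_of_measurable_coe _ fun s hs => ?_
  simp only [vMF, Measure.tilted]
  simp_rw [withDensity_apply _ hs]
  refine Measurable.lintegral_prod_right (ν := (surface D).restrict s) ?_
  exact (hc.measurable.div (hi.comp measurable_fst)).ennreal_ofReal

/-- The family of all von Mises-Fisher distributions, as a kernel in the parameters. -/
def vMFKernel (D : ℕ) : Kernel (Latent D × ℝ) (Latent D) where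
  toFun p := vMF p.1 p.2
  measurable' := measurable_vMF D

/-- The law of a positive latent given the reference latent `z`: `vMF(z, κpos)`. -/
def posKernel (D : ℕ) (κpos : ℝ) : Kernel (Latent D) (Latent D) :=
  (vMFKernel D).comap (fun z => (z, κpos)) (by fun_prop)

/-- A measurable assignment of von Mises-Fisher parameters (location and positive concentration)
to the observations. Encoders and the parameters of the true posteriors are of this form. -/
structure Encoder (X : Type*) [MeasurableSpace X] (D : ℕ) where
  /-- the location -/
  mean : X → Latent D
  /-- the concentration -/
  conc : X → ℝ
  measurable_mean : Measurable mean
  measurable_conc : Measurable conc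
  conc_pos : ∀ x, 0 < conc x

variable {X : Type*} [MeasurableSpace X] {D : ℕ}

/-- The conditional distribution of the latent given the observation `x`:
`vMF(mean x, conc x)`. -/
def Encoder.kernel (f : Encoder X D) : Kernel X (Latent D) :=
  (vMFKernel D).comap (fun x => (f.mean x, f.conc x))
    (f.measurable_mean.prodMk f.measurable_conc)

/-- The distribution `P(x)` of an observation generated from a uniform latent by the
likelihood `g`. -/
def obsLaw (g : Kernel (Latent D) X) : Measure X := g ∘ₘ unif D

/-- The joint distribution of an observation and a positive one: draw `z` uniformly and `z⁺` from
`vMF(z, κpos)`, then `x` from `g z` and `x⁺` from `g z⁺`, independently given `(z, z⁺)`. -/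
def pairLaw (κpos : ℝ) (g : Kernel (Latent D) X) : Measure (X × X) :=
  (g ∥ₖ g) ∘ₘ (unif D ⊗ₘ posKernel D κpos)

/-- The posterior of the latent given the observation, for a uniform latent and the likelihood
`g`, is `vMF(mean x, conc x)`: the joint law of `(x, z)` disintegrates accordingly. -/
def HasPosterior (g : Kernel (Latent D) X) (θ : Encoder X D) : Prop :=
  (unif D ⊗ₘ g).map Prod.swap = obsLaw g ⊗ₘ θ.kernel

/-- The aggregate latent distribution `∫ Q(z|x) dP(x)` of the encoder is uniform. -/
def UniformMarginal (P : Measure X) (f : Encoder X D) : Prop :=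
  f.kernel ∘ₘ P = unif D

/-- The InfoNCE fraction for a reference, a positive and `M` negative latents. -/
def infoNCERatio (κpos : ℝ) (M : ℕ) (z zp : Latent D) (zn : Fin M → Latent D) : ℝ :=
  Real.exp (κpos * dot z zp) /
    ((1 / (M : ℝ)) * Real.exp (κpos * dot z zp) +
      (1 / (M : ℝ)) * ∑ m, Real.exp (κpos * dot z (zn m)))

/-- The loss of one training tuple: minus the logarithm of the expected InfoNCE fraction, the
latents being drawn independently from the distributions that the encoder predicts. -/
def tupleLoss (κpos : ℝ) (M : ℕ) (f : Encoder X D) (x xp : X) (xn : Fin M → X) : ℝ :=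
  -Real.log (∫ z, ∫ zp, ∫ zn, infoNCERatio κpos M z zp zn
    ∂(Measure.pi fun m => f.kernel (xn m)) ∂(f.kernel xp) ∂(f.kernel x))

/-- The MCInfoNCE loss with `M` negatives. -/
def loss (κpos : ℝ) (g : Kernel (Latent D) X) (M : ℕ) (f : Encoder X D) : ℝ :=
  ∫ p : X × X, ∫ xn : Fin M → X, tupleLoss κpos M f p.1 p.2 xn
    ∂(Measure.pi fun _ => obsLaw g) ∂(pairLaw κpos g)

/-- The limit of the MCInfoNCE loss as the number of negatives tends to infinity. -/
def limitLoss (κpos : ℝ) (g : Kernel (Latent D) X) (f : Encoder X D) : ℝ :=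
  limUnder atTop (fun M : ℕ => loss κpos g M f)

/-- At the observation `x`, the encoder `f` has the concentration of `θ`, and the location of `θ`
transformed by the matrix `R`. -/
def AgreesAt (R : Matrix (Fin D) (Fin D) ℝ) (θ f : Encoder X D) (x : X) : Prop :=
  f.conc x = θ.conc x ∧
    (f.mean x : EuclideanSpace ℝ (Fin D)) = Matrix.toEuclideanLin R (θ.mean x)

end MCInfoNCE

end

open MCInfoNCE

/-! Averaged over the negative observations, the negative latents are independent and uniform,
because the aggregate marginal is. The denominator of the InfoNCE fraction therefore concentrates
around `normConst`, the mean of `exp (κ * dot z w)` over uniform `w`, which by rotation invariance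
does not depend on `z`. Every quantity lies between positive constants depending only on `κ`, so a
second-moment estimate suffices, and the loss tends to `crossEntropy`: the mean over positive pairs
of `-log q_f`, where `q_f` is `pairDensity`, that is, `pairing` divided by `normConst`
(`tendsto_loss`).

Bayes' rule shows that positive pairs have density `q_θ` with respect to `P ⊗ P`
(`pairLaw_eq_withDensity`), and uniformity of the marginals makes every `q_f` a probability density
(`integral_pairDensity`). Gibbs' inequality (`gibbs`) then makes `θ` a minimizer and forces `q_f =
q_θ` almost everywhere for any other minimizer.

It remains to recover the parameters from `pairing`. It is continuous, so equality almost everywhere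
becomes equality at any two points of the support of the law of the joint parameters
(`pairing_eq_of_mem_support`). This includes the diagonal, which may be a null set. On the diagonal
`pairing` is a strictly increasing function of the concentration alone, so the concentrations agree.
For fixed concentrations it is strictly increasing in the inner product of the locations, so the
locations have the same Gram matrix and differ by one orthogonal matrix. The monotonicity in the
inner product comes from reflecting the sphere, the one in the concentration from Chebyshev's
association inequality as well. -/

noncomputable section

namespace MCInfoNCE

/-! ### Reflections of the sphere and monotonicity along a direction -/

section Geometry

variable {D : ℕ}

lemma continuous_dot : Continuous (fun p : Latent D × Latent D => dot p.1 p.2) := by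
  unfold dot; fun_prop

@[fun_prop]
lemma continuous_dot_comp {Y : Type*} [TopologicalSpace Y] {f g : Y → Latent D}
    (hf : Continuous f) (hg : Continuous g) : Continuous (fun y => dot (f y) (g y)) :=
  continuous_dot.comp (hf.prodMk hg)

lemma dot_comm (z w : Latent D) : dot z w = dot w z := real_inner_comm _ _

lemma norm_latent (z : Latent D) : ‖(z : EuclideanSpace ℝ (Fin D))‖ = 1 :=
  mem_sphere_zero_iff_norm.1 z.2

lemma dot_self (z : Latent D) : dot z z = 1 := by
  simp [dot]

lemma abs_dot_le_one (z w : Latent D) : |dot z w| ≤ 1 := by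
  simpa [dot, norm_latent] using abs_real_inner_le_norm
    (z : EuclideanSpace ℝ (Fin D)) (w : EuclideanSpace ℝ (Fin D))

lemma dot_lt_one {z w : Latent D} (h : z ≠ w) : dot z w < 1 :=
  inner_lt_one_iff_real_of_norm_eq_one (norm_latent z) (norm_latent w) |>.2
    (fun e => h (Subtype.ext e))

/-- The action of a linear isometry on the latent sphere. -/
def rot (L : EuclideanSpace ℝ (Fin D) ≃ₗᵢ[ℝ] EuclideanSpace ℝ (Fin D)) (z : Latent D) :
    Latent D :=
  ⟨L z, by simp⟩

@[fun_prop]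
lemma continuous_rot (L : EuclideanSpace ℝ (Fin D) ≃ₗᵢ[ℝ] EuclideanSpace ℝ (Fin D)) :
    Continuous (rot L) := by
  unfold rot
  exact (L.continuous.comp continuous_subtype_val).subtype_mk _

lemma dot_rot_rot (L : EuclideanSpace ℝ (Fin D) ≃ₗᵢ[ℝ] EuclideanSpace ℝ (Fin D))
    (z w : Latent D) : dot (rot L z) (rot L w) = dot z w := by
  simp [dot, rot]

open scoped Pointwise in
-- The surface measure of a set is a multiple of the volume of the cone over it; isometries map
-- cones to cones and preserve volume.
lemma measurePreserving_rot (L : EuclideanSpace ℝ (Fin D) ≃ₗᵢ[ℝ] EuclideanSpace ℝ (Fin D)) :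
    MeasurePreserving (rot L) (surface D) (surface D) := by
  refine ⟨(continuous_rot L).measurable, Measure.ext fun s hs => ?_⟩
  have hm := (continuous_rot L).measurable
  rw [Measure.map_apply hm hs, surface, Measure.toSphere_apply' _ hs,
    Measure.toSphere_apply' _ (hm hs)]
  congr 1
  have key : Set.Ioo (0 : ℝ) 1 • (Subtype.val '' (rot L ⁻¹' s)) =
      L ⁻¹' (Set.Ioo (0 : ℝ) 1 • (Subtype.val '' s)) := by
    ext v
    simp only [Set.mem_smul, Set.mem_preimage, Set.mem_image]
    constructor
    · rintro ⟨r, hr, _, ⟨z, hz, rfl⟩, rfl⟩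
      exact ⟨r, hr, _, ⟨rot L z, hz, rfl⟩, by simp [rot]⟩
    · rintro ⟨r, hr, _, ⟨z, hz, rfl⟩, h⟩
      refine ⟨r, hr, _, ⟨rot L.symm z, ?_, rfl⟩, ?_⟩
      · have : rot L (rot L.symm z) = z := by ext1; simp [rot]
        exact this.symm ▸ hz
      · apply L.injective
        simpa [rot] using h
  rw [key]
  exact (L.measurePreserving.measure_preimage_equiv (f := L.toMeasurableEquiv) _)

lemma integral_rot (L : EuclideanSpace ℝ (Fin D) ≃ₗᵢ[ℝ] EuclideanSpace ℝ (Fin D))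
    {G : Latent D → ℝ} (hG : Continuous G) :
    ∫ z, G (rot L z) ∂(surface D) = ∫ z, G z ∂(surface D) := by
  conv_rhs => rw [← (measurePreserving_rot L).map_eq]
  rw [integral_map (continuous_rot L).measurable.aemeasurable hG.aestronglyMeasurable]

/-- The reflection of the sphere which exchanges the points `a` and `b`. -/
def swapIso (a b : Latent D) : EuclideanSpace ℝ (Fin D) ≃ₗᵢ[ℝ] EuclideanSpace ℝ (Fin D) :=
  (ℝ ∙ ((b : EuclideanSpace ℝ (Fin D)) - a))ᗮ.reflection

lemma rot_swapIso_right (a b : Latent D) : rot (swapIso a b) b = a :=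
  Subtype.ext (Submodule.reflection_sub (by simp))

lemma rot_swapIso_rot (a b z : Latent D) : rot (swapIso a b) (rot (swapIso a b) z) = z :=
  Subtype.ext (Submodule.reflection_reflection _ _)

lemma rot_swapIso_left (a b : Latent D) : rot (swapIso a b) a = b := by
  simpa only [rot_swapIso_right] using rot_swapIso_rot a b b

/-- The reflection removes twice the component along `b - a`. Only the sign matters later: when `m`
is closer to `b`, reflecting a point on the side of `b` lowers its inner product with `m`. -/
lemma dot_sub_dot_swapIso (a b m z : Latent D) :
    dot m z - dot m (rot (swapIso a b) z) =
      2 / ‖(b : EuclideanSpace ℝ (Fin D)) - a‖ ^ 2 * (dot m b - dot m a) * (dot b z - dot a z) := by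
  simp only [dot, rot, swapIso, Submodule.reflection_orthogonal_apply,
    Submodule.reflection_singleton_apply]
  simp only [inner_neg_right, inner_sub_right, inner_smul_right, inner_sub_left, two_smul,
    inner_add_right]
  simp
  ring

/-- `G` is strictly increasing in the direction `m`. -/
def StrictMonoAlong (m : Latent D) (G : Latent D → ℝ) : Prop :=
  ∀ z w, dot m z < dot m w → G z < G w

lemma integrable_of_continuous {Y : Type*} [TopologicalSpace Y] [CompactSpace Y]
    [MeasurableSpace Y] [OpensMeasurableSpace Y] {μ : Measure Y}
    [IsFiniteMeasure μ] {G : Y → ℝ} (hG : Continuous G) : Integrable G μ :=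
  hG.integrable_of_hasCompactSupport (HasCompactSupport.of_compactSpace G)

instance (D : ℕ) : (surface D).IsOpenPosMeasure := by
  unfold surface; infer_instance

lemma integral_surface_pos {G : Latent D → ℝ} (hG : Continuous G) (h0 : ∀ z, 0 ≤ G z)
    {a : Latent D} (ha : 0 < G a) : 0 < ∫ z, G z ∂(surface D) :=
  hG.integral_pos_of_hasCompactSupport_nonneg_nonzero (HasCompactSupport.of_compactSpace G)
    h0 ha.ne'

/-- Integration against the kernel `exp (k * dot z w)` preserves strict monotonicity along `m`. -/
lemma StrictMonoAlong.integral_exp_dot {m : Latent D} {G : Latent D → ℝ}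
    (h : StrictMonoAlong m G) (hG : Continuous G) {k : ℝ} (hk : 0 < k) :
    StrictMonoAlong m (fun z => ∫ w, Real.exp (k * dot z w) * G w ∂(surface D)) := by
  intro a b hab
  have hne : a ≠ b := by rintro rfl; exact lt_irrefl _ hab
  set s := rot (swapIso a b) with hs
  have hsc : Continuous s := continuous_rot _
  have key : ∀ c d : Latent D, s c = d →
      ∫ w, Real.exp (k * dot d w) * G w ∂(surface D) =
        ∫ w, Real.exp (k * dot c w) * G (s w) ∂(surface D) := by
    rintro c d rfl
    rw [← integral_rot (swapIso a b) (by fun_prop)]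
    simp only [← hs]
    simp_rw [hs, dot_rot_rot]
  have e1 := key b a (rot_swapIso_right a b)
  have e2 := key a b (rot_swapIso_left a b)
  -- By `e1` and `e2` this integral is twice the difference to be shown positive. Its integrand is
  -- nonnegative, since both factors change sign across the mirror, and it is positive at `w = b`.
  have hpos : 0 < ∫ w, (Real.exp (k * dot b w) - Real.exp (k * dot a w)) * (G w - G (s w))
      ∂(surface D) := by
    have hc : 0 < 2 / ‖(b : EuclideanSpace ℝ (Fin D)) - a‖ ^ 2 := by
      have : 0 < ‖(b : EuclideanSpace ℝ (Fin D)) - a‖ :=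
        norm_pos_iff.2 (sub_ne_zero.2 fun e => hne (Subtype.ext e.symm))
      positivity
    have hmul := mul_pos hc (sub_pos.2 hab)
    have hgt : ∀ w, dot a w < dot b w →
        0 < (Real.exp (k * dot b w) - Real.exp (k * dot a w)) * (G w - G (s w)) := by
      intro w hw
      refine mul_pos (sub_pos.2 (Real.exp_lt_exp.2 (by gcongr))) (sub_pos.2 (h _ _ ?_))
      have := dot_sub_dot_swapIso a b m w
      have h2 := mul_pos hmul (sub_pos.2 hw)
      rw [← this] at h2
      linarith
    refine integral_surface_pos (by fun_prop) (fun w => ?_)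
      (hgt b (by rw [dot_self]; exact dot_lt_one hne))
    rcases lt_trichotomy (dot a w) (dot b w) with hw | hw | hw
    · exact (hgt w hw).le
    · simp [hw]
    · refine mul_nonneg_of_nonpos_of_nonpos
        (sub_nonpos.2 (Real.exp_le_exp.2 (by gcongr))) (sub_nonpos.2 (h _ _ ?_).le)
      have := dot_sub_dot_swapIso a b m w
      have h2 := mul_pos hmul (sub_pos.2 hw)
      rw [show (dot b w - dot a w) = - (dot a w - dot b w) by ring, mul_neg] at this
      linarith
  have expand : ∫ w, (Real.exp (k * dot b w) - Real.exp (k * dot a w)) * (G w - G (s w))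
      ∂(surface D) = (∫ w, Real.exp (k * dot b w) * G w ∂(surface D)
        - ∫ w, Real.exp (k * dot b w) * G (s w) ∂(surface D))
        - (∫ w, Real.exp (k * dot a w) * G w ∂(surface D)
        - ∫ w, Real.exp (k * dot a w) * G (s w) ∂(surface D)) := by
    rw [← integral_sub, ← integral_sub, ← integral_sub]
    · congr with w; ring
    all_goals exact integrable_of_continuous (by fun_prop)
  rw [expand] at hpos
  simp only
  linarith

lemma strictMonoAlong_exp_dot (m : Latent D) {k : ℝ} (hk : 0 < k) :
    StrictMonoAlong m (fun z => Real.exp (k * dot m z)) :=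
  fun _ _ h => Real.exp_lt_exp.2 (mul_lt_mul_of_pos_left h hk)

end Geometry

/-! ### Von Mises-Fisher expectations and what the pairing determines -/

section VonMisesFisher

variable {D : ℕ}

instance [NeZero D] : NeZero (surface D) := by
  unfold surface; exact ⟨Measure.toSphere_ne_zero _⟩

instance [NeZero D] (m : Latent D) (k : ℝ) : IsProbabilityMeasure (vMF m k) :=
  isProbabilityMeasure_tilted (integrable_of_continuous (by fun_prop))

lemma partition_pos [NeZero D] (m : Latent D) (k : ℝ) :
    0 < ∫ z, Real.exp (k * dot m z) ∂(surface D) :=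
  MeasureTheory.integral_exp_pos (integrable_of_continuous (by fun_prop))

lemma partition_eq (a b : Latent D) (k : ℝ) :
    ∫ z, Real.exp (k * dot a z) ∂(surface D) = ∫ z, Real.exp (k * dot b z) ∂(surface D) := by
  rw [← integral_rot (swapIso a b) (by fun_prop)]
  congr with z
  rw [← dot_rot_rot (swapIso a b) b z, rot_swapIso_right]

lemma integral_vMF (m : Latent D) (k : ℝ) (G : Latent D → ℝ) :
    ∫ z, G z ∂(vMF m k) = (∫ z, Real.exp (k * dot m z) * G z ∂(surface D)) /
      ∫ z, Real.exp (k * dot m z) ∂(surface D) := by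
  rw [vMF, integral_tilted, ← integral_div]
  congr with z
  rw [smul_eq_mul]; ring

lemma continuous_integral_surface {Y : Type*} [TopologicalSpace Y] [FirstCountableTopology Y]
    [LocallyCompactSpace Y] {G : Y → Latent D → ℝ} (hG : Continuous (Function.uncurry G)) :
    Continuous (fun y => ∫ z, G y z ∂(surface D)) := by
  have := continuous_parametric_integral_of_continuous (μ := surface D) hG isCompact_univ
  simpa only [Measure.restrict_univ] using this

lemma continuous_integral_vMF [NeZero D] {Y : Type*} [TopologicalSpace Y]
    [FirstCountableTopology Y] [LocallyCompactSpace Y] {G : Y → Latent D → ℝ}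
    (hG : Continuous (Function.uncurry G)) {p : Y → Latent D × ℝ} (hp : Continuous p) :
    Continuous (fun y => ∫ z, G y z ∂(vMF (p y).1 (p y).2)) := by
  simp_rw [integral_vMF]
  refine Continuous.div (continuous_integral_surface ?_) (continuous_integral_surface ?_)
    fun y => (partition_pos _ _).ne'
  · exact Continuous.mul (by fun_prop) hG
  · fun_prop

lemma integral_vMF_rot (L : EuclideanSpace ℝ (Fin D) ≃ₗᵢ[ℝ] EuclideanSpace ℝ (Fin D))
    (m : Latent D) (k : ℝ) {G : Latent D → ℝ} (hG : Continuous G) :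
    ∫ z, G z ∂(vMF (rot L m) k) = ∫ z, G (rot L z) ∂(vMF m k) := by
  rw [integral_vMF, integral_vMF, ← integral_rot L (by fun_prop),
    ← integral_rot L (G := fun z => Real.exp (k * dot (rot L m) z)) (by fun_prop)]
  simp_rw [dot_rot_rot]

lemma StrictMonoAlong.integral_vMF_lt [NeZero D] {m : Latent D} {G : Latent D → ℝ}
    (h : StrictMonoAlong m G) (hG : Continuous G) {k : ℝ} (hk : 0 < k) :
    StrictMonoAlong m (fun z => ∫ w, G w ∂(vMF z k)) := by
  intro a b hab
  simp only [integral_vMF]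
  rw [partition_eq a b]
  exact div_lt_div_of_pos_right (h.integral_exp_dot hG hk a b hab) (partition_pos _ _)

/-- A function which is strictly increasing along `m` has a larger mean under a more concentrated
distribution. -/
lemma StrictMonoAlong.integral_vMF_conc_lt [NeZero D] {m : Latent D} {G : Latent D → ℝ}
    (h : StrictMonoAlong m G) (hG : Continuous G) {k l : ℝ} (hkl : k < l) :
    ∫ z, G z ∂(vMF m k) < ∫ z, G z ∂(vMF m l) := by
  rw [integral_vMF, integral_vMF, div_lt_div_iff₀ (partition_pos _ _) (partition_pos _ _)]
  set σ := surface D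
  set A : Latent D → ℝ := fun z => Real.exp (k * dot m z) with hA
  set B : Latent D → ℝ := fun z => Real.exp (l * dot m z) with hB
  have hAc : Continuous A := by fun_prop
  have hBc : Continuous B := by fun_prop
  have hint : ∀ {F : Latent D → ℝ}, Continuous F → Integrable F σ :=
    fun hF => integrable_of_continuous hF
  -- Chebyshev's association argument: the double integral of this product is twice the
  -- cross-multiplied difference of the two means. The second factor has the sign of `(l - k) * (dot
  -- m z - dot m w)`, matching that of `G z - G w`, and vanishes when the inner products are equal.
  have hinner : ∀ z, ∫ w, (G z - G w) * (B z * A w - A z * B w) ∂σ =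
      G z * B z * ∫ w, A w ∂σ - G z * A z * ∫ w, B w ∂σ - B z * ∫ w, A w * G w ∂σ
        + A z * ∫ w, B w * G w ∂σ := by
    intro z
    simp_rw [← integral_const_mul]
    rw [← integral_sub, ← integral_sub, ← integral_add]
    · congr with w; ring
    all_goals exact hint (by fun_prop)
  have hcont : Continuous (fun z => ∫ w, (G z - G w) * (B z * A w - A z * B w) ∂σ) := by
    simp_rw [hinner]; fun_prop
  have hnn : ∀ z w, 0 ≤ (G z - G w) * (B z * A w - A z * B w) := by
    intro z w
    simp only [hA, hB, ← Real.exp_add]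
    rcases lt_trichotomy (dot m z) (dot m w) with hw | hw | hw
    · refine mul_nonneg_of_nonpos_of_nonpos (sub_nonpos.2 (h _ _ hw).le)
        (sub_nonpos.2 (Real.exp_le_exp.2 ?_))
      nlinarith
    · rw [hw, add_comm (k * _), sub_self, mul_zero]
    · refine mul_nonneg (sub_nonneg.2 (h _ _ hw).le)
        (sub_nonneg.2 (Real.exp_le_exp.2 ?_))
      nlinarith
  have hpos : 0 < ∫ z, ∫ w, (G z - G w) * (B z * A w - A z * B w) ∂σ ∂σ := by
    -- The antipodal pair `z = m`, `w = -m` has the inner products 1 and -1 with `m`, so the product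
    -- is strictly positive there.
    refine integral_surface_pos hcont (fun z => integral_nonneg (hnn z)) (a := m) ?_
    refine integral_surface_pos (by fun_prop) (hnn m) (a := -m) ?_
    have hmm : dot m (-m) = -1 := by
      rw [show dot m (-m) = -dot m m from inner_neg_right _ _, dot_self]
    simp only [hA, hB, ← Real.exp_add, dot_self, hmm]
    refine mul_pos (sub_pos.2 (h _ _ ?_)) (sub_pos.2 (Real.exp_lt_exp.2 ?_))
    · rw [dot_self, hmm]; norm_num
    · linarith
  have htot : ∫ z, ∫ w, (G z - G w) * (B z * A w - A z * B w) ∂σ ∂σ =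
      2 * ((∫ z, B z * G z ∂σ) * (∫ z, A z ∂σ) - (∫ z, A z * G z ∂σ) * (∫ z, B z ∂σ)) := by
    simp_rw [hinner]
    rw [integral_add, integral_sub, integral_sub]
    · simp_rw [integral_mul_const]
      simp_rw [mul_comm (G _)]
      ring
    all_goals exact hint (by fun_prop)
  linarith

/-- The expected value of `exp (κ * dot z w)` under independent von Mises-Fisher latents. -/
def pairing (κ : ℝ) (p q : Latent D × ℝ) : ℝ :=
  ∫ z, ∫ w, Real.exp (κ * dot z w) ∂(vMF q.1 q.2) ∂(vMF p.1 p.2)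

lemma continuous_pairing [NeZero D] (κ : ℝ) :
    Continuous (fun r : (Latent D × ℝ) × (Latent D × ℝ) => pairing κ r.1 r.2) := by
  unfold pairing
  refine continuous_integral_vMF (p := Prod.fst) ?_ (by fun_prop)
  exact continuous_integral_vMF
    (G := fun (y : ((Latent D × ℝ) × (Latent D × ℝ)) × Latent D) w => Real.exp (κ * dot y.2 w))
    (p := fun y => y.1.2) (by fun_prop) (by fun_prop)

lemma continuous_integral_exp_dot [NeZero D] (κ : ℝ) (p : Latent D × ℝ) :
    Continuous (fun z => ∫ w, Real.exp (κ * dot z w) ∂(vMF p.1 p.2)) :=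
  continuous_integral_vMF (G := fun z w => Real.exp (κ * dot z w)) (p := fun _ => p)
    (by fun_prop) (by fun_prop)

lemma pairing_rot [NeZero D] (L : EuclideanSpace ℝ (Fin D) ≃ₗᵢ[ℝ] EuclideanSpace ℝ (Fin D))
    (κ : ℝ) (a b : Latent D) (k l : ℝ) :
    pairing κ (rot L a, k) (rot L b, l) = pairing κ (a, k) (b, l) := by
  simp only [pairing]
  rw [integral_vMF_rot L a k (continuous_integral_exp_dot κ (rot L b, l))]
  congr with z
  rw [integral_vMF_rot L b l (by fun_prop)]
  simp_rw [dot_rot_rot]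

lemma pairing_comm [NeZero D] (κ : ℝ) (p q : Latent D × ℝ) : pairing κ p q = pairing κ q p := by
  unfold pairing
  rw [integral_integral_swap (integrable_of_continuous (by fun_prop))]
  simp_rw [dot_comm]

/-- The density of `vMF m k` itself increases along `m`, and smoothing by the kernel preserves this.
-/
lemma strictMonoAlong_integral_exp_dot [NeZero D] {κ : ℝ} (hκ : 0 < κ) (m : Latent D) {k : ℝ}
    (hk : 0 < k) : StrictMonoAlong m (fun z => ∫ w, Real.exp (κ * dot z w) ∂(vMF m k)) := by
  intro a b hab
  simp only [integral_vMF]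
  refine div_lt_div_of_pos_right ?_ (partition_pos _ _)
  simp_rw [mul_comm (Real.exp (k * _))]
  exact (strictMonoAlong_exp_dot m hk).integral_exp_dot (by fun_prop) hκ a b hab

lemma pairing_lt_of_dot_lt [NeZero D] {κ : ℝ} (hκ : 0 < κ) {a b m : Latent D} {k l : ℝ}
    (hk : 0 < k) (hl : 0 < l) (hab : dot m a < dot m b) :
    pairing κ (a, k) (m, l) < pairing κ (b, k) (m, l) :=
  (strictMonoAlong_integral_exp_dot hκ m hl).integral_vMF_lt
    (continuous_integral_exp_dot κ (m, l)) hk a b hab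

/-- The concentration is raised in one argument at a time, using the symmetry of `pairing` in
between. -/
lemma pairing_self_lt_of_conc_lt [NeZero D] {κ : ℝ} (hκ : 0 < κ) (m : Latent D) {k l : ℝ}
    (hk : 0 < k) (hkl : k < l) : pairing κ (m, k) (m, k) < pairing κ (m, l) (m, l) := by
  calc pairing κ (m, k) (m, k) < pairing κ (m, l) (m, k) :=
        (strictMonoAlong_integral_exp_dot hκ m hk).integral_vMF_conc_lt
          (continuous_integral_exp_dot κ (m, k)) hkl
    _ = pairing κ (m, k) (m, l) := pairing_comm _ _ _
    _ < pairing κ (m, l) (m, l) :=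
        (strictMonoAlong_integral_exp_dot hκ m (hk.trans hkl)).integral_vMF_conc_lt
          (continuous_integral_exp_dot κ (m, l)) hkl

lemma conc_eq_of_pairing_self_eq [NeZero D] {κ : ℝ} (hκ : 0 < κ) {a b : Latent D} {k l : ℝ}
    (hk : 0 < k) (hl : 0 < l) (h : pairing κ (a, k) (a, k) = pairing κ (b, l) (b, l)) : k = l := by
  have h' : pairing κ (a, k) (a, k) = pairing κ (a, l) (a, l) := by
    rw [h, ← pairing_rot (swapIso a b) κ b b, rot_swapIso_right]
  rcases lt_trichotomy k l with hkl | hkl | hkl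
  · exact absurd h' (pairing_self_lt_of_conc_lt hκ a hk hkl).ne
  · exact hkl
  · exact absurd h' (pairing_self_lt_of_conc_lt hκ a hl hkl).ne'

/-- A reflection taking `b'` to `b` moves both pairs to a common second location, where strict
monotonicity in the inner product applies. -/
lemma dot_eq_of_pairing_eq [NeZero D] {κ : ℝ} (hκ : 0 < κ) {a b a' b' : Latent D} {k l : ℝ}
    (hk : 0 < k) (hl : 0 < l) (h : pairing κ (a, k) (b, l) = pairing κ (a', k) (b', l)) :
    dot a b = dot a' b' := by
  set c := rot (swapIso b b') a' with hc
  have hd : dot b c = dot a' b' := by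
    rw [← dot_rot_rot (swapIso b b') a' b', rot_swapIso_right, dot_comm]
  have h' : pairing κ (a, k) (b, l) = pairing κ (c, k) (b, l) := by
    rw [h, ← pairing_rot (swapIso b b') κ a' b', rot_swapIso_right]
  rw [← hd, dot_comm]
  rcases lt_trichotomy (dot b a) (dot b c) with h1 | h1 | h1
  · exact absurd h' (pairing_lt_of_dot_lt hκ hk hl h1).ne
  · exact h1
  · exact absurd h' (pairing_lt_of_dot_lt hκ hk hl h1).ne'

/-- Two families of vectors with the same inner products differ by an orthogonal matrix. -/
lemma exists_orthogonal_of_inner_eq {ι : Type*} (u v : ι → EuclideanSpace ℝ (Fin D))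
    (h : ∀ i j, ⟪u i, u j⟫ = ⟪v i, v j⟫) :
    ∃ R ∈ Matrix.orthogonalGroup (Fin D) ℝ, ∀ i, v i = Matrix.toEuclideanLin R (u i) := by
  set lu := Finsupp.linearCombination ℝ u with hlu
  set lv := Finsupp.linearCombination ℝ v with hlv
  -- Equal Gram matrices give equal norms of corresponding linear combinations, so sending `lu c` to
  -- `lv c` is a well-defined isometry on the span of `u`; it then extends to the whole space.
  have hnorm : ∀ c, ‖lu c‖ = ‖lv c‖ := by
    intro c
    have : ⟪lu c, lu c⟫ = ⟪lv c, lv c⟫ := by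
      simp only [hlu, hlv, Finsupp.linearCombination_apply, Finsupp.sum_inner, Finsupp.inner_sum,
        real_inner_smul_left, real_inner_smul_right, h]
    rw [real_inner_self_eq_norm_sq, real_inner_self_eq_norm_sq] at this
    exact (pow_left_inj₀ (norm_nonneg _) (norm_nonneg _) two_ne_zero).1 this
  obtain ⟨s, hs⟩ := lu.rangeRestrict.exists_rightInverse_of_surjective
    (LinearMap.range_rangeRestrict lu)
  have hs' : ∀ x, lu (s x) = x := fun x => congrArg Subtype.val (LinearMap.congr_fun hs x)
  let L₀ : LinearMap.range lu →ₗᵢ[ℝ] EuclideanSpace ℝ (Fin D) :=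
    { toLinearMap := lv ∘ₗ s
      norm_map' := fun x => by
        rw [LinearMap.comp_apply, ← hnorm, hs']; rfl }
  set L := L₀.extend
  have hL : ∀ i, L (u i) = v i := by
    intro i
    have hu : lu (Finsupp.single i 1) = u i := by simp [hlu]
    have hv : lv (Finsupp.single i 1) = v i := by simp [hlv]
    have h1 : L (u i) = lv (s ⟨u i, ⟨_, hu⟩⟩) := L₀.extend_apply ⟨u i, ⟨_, hu⟩⟩
    -- The section `s` may choose coefficients other than `single i 1`. The difference is killed by
    -- `lu`, hence by `lv`, because of `hnorm`.
    rw [h1, ← hv, ← sub_eq_zero, ← map_sub, ← norm_eq_zero, ← hnorm, norm_eq_zero, map_sub, hs',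
      hu, sub_self]
  refine ⟨Matrix.toEuclideanLin.symm L.toLinearMap, ?_, fun i => ?_⟩
  · rw [Matrix.mem_orthogonalGroup_iff']
    set R := Matrix.toEuclideanLin.symm L.toLinearMap with hR
    have hent : ∀ k i, R k i = L (EuclideanSpace.single i 1) k := by
      intro k i
      have : L (EuclideanSpace.single i 1) = Matrix.toEuclideanLin R (EuclideanSpace.single i 1) := by
        simp [hR]
      rw [this]
      simp [Matrix.toLpLin_apply]
    ext i j
    have := L.inner_map_map (EuclideanSpace.single i 1) (EuclideanSpace.single j (1 : ℝ))
    rw [PiLp.inner_apply, EuclideanSpace.inner_single_left] at this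
    simp only [Matrix.mul_apply, Matrix.transpose_apply, hent]
    simpa [Matrix.one_apply, eq_comm, mul_comm] using this.symm
  · simp [hL]

end VonMisesFisher

/-! ### The predicted density of positive pairs and Gibbs' inequality -/

section PairDensity

variable {X : Type*} [MeasurableSpace X] {D : ℕ}

instance [NeZero D] : IsProbabilityMeasure (unif D) := by
  refine ⟨?_⟩
  rw [unif, Measure.smul_apply, smul_eq_mul]
  exact ENNReal.inv_mul_cancel (NeZero.ne _ |> fun h => by
    simpa [Measure.measure_univ_eq_zero] using h) (measure_ne_top _ _)

instance [NeZero D] (κ : ℝ) : IsMarkovKernel (posKernel D κ) :=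
  ⟨fun z => inferInstanceAs (IsProbabilityMeasure (vMF z κ))⟩

instance [NeZero D] (f : Encoder X D) : IsMarkovKernel f.kernel :=
  ⟨fun x => inferInstanceAs (IsProbabilityMeasure (vMF (f.mean x) (f.conc x)))⟩

instance [NeZero D] (g : Kernel (Latent D) X) [IsMarkovKernel g] :
    IsProbabilityMeasure (obsLaw g) := by
  unfold obsLaw; infer_instance

instance [NeZero D] (κ : ℝ) (g : Kernel (Latent D) X) [IsMarkovKernel g] :
    IsProbabilityMeasure (pairLaw κ g) := by
  unfold pairLaw; infer_instance

variable (D) in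
/-- The mean of `exp (κ * dot z w)` under independent uniform latents. -/
def normConst (κ : ℝ) : ℝ := ∫ z, ∫ w, Real.exp (κ * dot z w) ∂(unif D) ∂(unif D)

lemma integral_unif (G : Latent D → ℝ) :
    ∫ z, G z ∂(unif D) = ((surface D).real Set.univ)⁻¹ * ∫ z, G z ∂(surface D) := by
  rw [unif, integral_smul_measure, smul_eq_mul, ENNReal.toReal_inv]; rfl

lemma integral_exp_dot_unif [NeZero D] (κ : ℝ) (z : Latent D) :
    ∫ w, Real.exp (κ * dot z w) ∂(unif D) = normConst D κ := by
  have : ∀ z', ∫ w, Real.exp (κ * dot z' w) ∂(unif D) = ∫ w, Real.exp (κ * dot z w) ∂(unif D) := by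
    intro z'
    rw [integral_unif, integral_unif, partition_eq z' z]
  simp [normConst, this]

section Bounds

variable {κ : ℝ} (hκ : 0 ≤ κ)
include hκ

lemma exp_neg_le_exp_dot (z w : Latent D) : Real.exp (-κ) ≤ Real.exp (κ * dot z w) := by
  have := (abs_le.1 (abs_dot_le_one z w)).1
  exact Real.exp_le_exp.2 (by nlinarith)

lemma exp_dot_le_exp (z w : Latent D) : Real.exp (κ * dot z w) ≤ Real.exp κ := by
  have := (abs_le.1 (abs_dot_le_one z w)).2
  exact Real.exp_le_exp.2 (by nlinarith)

end Bounds

lemma le_integral_of_forall_le {Y : Type*} [MeasurableSpace Y] {μ : Measure Y}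
    [IsProbabilityMeasure μ] {F : Y → ℝ} {c : ℝ} (hF : Integrable F μ) (h : ∀ y, c ≤ F y) :
    c ≤ ∫ y, F y ∂μ := by
  simpa using integral_mono (integrable_const c) hF h

lemma integral_le_of_forall_le {Y : Type*} [MeasurableSpace Y] {μ : Measure Y}
    [IsProbabilityMeasure μ] {F : Y → ℝ} {c : ℝ} (hF : Integrable F μ) (h : ∀ y, F y ≤ c) :
    ∫ y, F y ∂μ ≤ c := by
  simpa using integral_mono hF (integrable_const c) h

lemma exp_neg_le_normConst [NeZero D] {κ : ℝ} (hκ : 0 ≤ κ) : Real.exp (-κ) ≤ normConst D κ := by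
  obtain ⟨z⟩ := nonempty_of_isProbabilityMeasure (unif D)
  rw [← integral_exp_dot_unif κ z]
  exact le_integral_of_forall_le (integrable_of_continuous (by fun_prop))
    (exp_neg_le_exp_dot hκ z)

lemma normConst_le_exp [NeZero D] {κ : ℝ} (hκ : 0 ≤ κ) : normConst D κ ≤ Real.exp κ := by
  obtain ⟨z⟩ := nonempty_of_isProbabilityMeasure (unif D)
  rw [← integral_exp_dot_unif κ z]
  exact integral_le_of_forall_le (integrable_of_continuous (by fun_prop))
    (exp_dot_le_exp hκ z)

lemma normConst_pos [NeZero D] {κ : ℝ} (hκ : 0 ≤ κ) : 0 < normConst D κ :=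
  (Real.exp_pos _).trans_le (exp_neg_le_normConst hκ)

lemma exp_neg_le_pairing [NeZero D] {κ : ℝ} (hκ : 0 ≤ κ) (p q : Latent D × ℝ) :
    Real.exp (-κ) ≤ pairing κ p q :=
  le_integral_of_forall_le (integrable_of_continuous (continuous_integral_exp_dot κ q)) fun z =>
    le_integral_of_forall_le (integrable_of_continuous (by fun_prop)) (exp_neg_le_exp_dot hκ z)

lemma pairing_le_exp [NeZero D] {κ : ℝ} (hκ : 0 ≤ κ) (p q : Latent D × ℝ) :
    pairing κ p q ≤ Real.exp κ :=
  integral_le_of_forall_le (integrable_of_continuous (continuous_integral_exp_dot κ q)) fun z =>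
    integral_le_of_forall_le (integrable_of_continuous (by fun_prop)) (exp_dot_le_exp hκ z)

/-- The von Mises-Fisher parameters which an encoder assigns to an observation. -/
def Encoder.params (f : Encoder X D) (x : X) : Latent D × ℝ := (f.mean x, f.conc x)

@[fun_prop]
lemma Encoder.measurable_params (f : Encoder X D) : Measurable f.params :=
  f.measurable_mean.prodMk f.measurable_conc

/-- The density of positive pairs with respect to independent pairs of observations, as predicted
by the encoder `f`. -/
def pairDensity (κ : ℝ) (f : Encoder X D) (p : X × X) : ℝ :=
  pairing κ (f.params p.1) (f.params p.2) / normConst D κ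

@[fun_prop]
lemma measurable_pairDensity [NeZero D] (κ : ℝ) (f : Encoder X D) :
    Measurable (pairDensity κ f) :=
  ((continuous_pairing κ).measurable.comp (by fun_prop :
    Measurable fun p : X × X => (f.params p.1, f.params p.2))).div_const _

lemma pairDensity_mem_Icc [NeZero D] {κ : ℝ} (hκ : 0 ≤ κ) (f : Encoder X D) (p : X × X) :
    pairDensity κ f p ∈ Set.Icc (Real.exp (-κ) / Real.exp κ) (Real.exp κ / Real.exp (-κ)) := by
  constructor
  · exact div_le_div₀ ((Real.exp_pos _).le.trans (exp_neg_le_pairing hκ _ _))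
      (exp_neg_le_pairing hκ _ _) (normConst_pos hκ) (normConst_le_exp hκ)
  · exact div_le_div₀ (Real.exp_pos _).le (pairing_le_exp hκ _ _) (Real.exp_pos _)
      (exp_neg_le_normConst hκ)

lemma pairDensity_pos [NeZero D] {κ : ℝ} (hκ : 0 ≤ κ) (f : Encoder X D) (p : X × X) :
    0 < pairDensity κ f p :=
  lt_of_lt_of_le (by positivity) (pairDensity_mem_Icc hκ f p).1

lemma continuous_integral_exp_dot_params [NeZero D] (κ : ℝ) :
    Continuous (fun r : (Latent D × ℝ) × Latent D =>
      ∫ w, Real.exp (κ * dot r.2 w) ∂(vMF r.1.1 r.1.2)) :=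
  continuous_integral_vMF (G := fun (r : (Latent D × ℝ) × Latent D) w =>
    Real.exp (κ * dot r.2 w)) (p := fun r => r.1) (by fun_prop) (by fun_prop)

lemma integral_comp_measure {Y Z : Type*} [MeasurableSpace Y] [MeasurableSpace Z]
    {μ : Measure Y} {η : Kernel Y Z} {G : Z → ℝ} (hG : Integrable G (η ∘ₘ μ)) :
    ∫ z, G z ∂(η ∘ₘ μ) = ∫ y, ∫ z, G z ∂(η y) ∂μ := by
  rw [Measure.comp_eq_comp_const_apply] at hG ⊢
  rw [Kernel.integral_comp hG, Kernel.const_apply]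

/-- Averaging the predicted latent law over `y` gives the uniform law, against which the mean of
`exp (κ * dot z w)` is `normConst` for every `z`. -/
lemma integral_pairDensity_right [NeZero D] {κ : ℝ} (hκ : 0 ≤ κ) {P : Measure X}
    [IsProbabilityMeasure P] {f : Encoder X D} (hf : UniformMarginal P f) (x : X) :
    ∫ y, pairDensity κ f (x, y) ∂P = 1 := by
  have hmeas : Measurable (fun q : X × Latent D =>
      ∫ w, Real.exp (κ * dot q.2 w) ∂(vMF (f.params q.1).1 (f.params q.1).2)) :=
    Measurable.comp (g := fun r : (Latent D × ℝ) × Latent D =>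
      ∫ w, Real.exp (κ * dot r.2 w) ∂(vMF r.1.1 r.1.2))
      (f := fun q : X × Latent D => (f.params q.1, q.2))
      (continuous_integral_exp_dot_params κ).measurable (by fun_prop)
  have hbound : ∀ q : X × Latent D,
      ‖∫ w, Real.exp (κ * dot q.2 w) ∂(vMF (f.params q.1).1 (f.params q.1).2)‖ ≤ Real.exp κ := by
    intro q
    rw [Real.norm_of_nonneg (integral_nonneg fun _ => (Real.exp_pos _).le)]
    exact integral_le_of_forall_le (integrable_of_continuous (by fun_prop))
      (exp_dot_le_exp hκ q.2)
  simp only [pairDensity, pairing]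
  rw [integral_div, integral_integral_swap]
  · have : ∀ z : Latent D,
        ∫ y, ∫ w, Real.exp (κ * dot z w) ∂(vMF (f.params y).1 (f.params y).2) ∂P =
          normConst D κ := by
      intro z
      rw [← integral_exp_dot_unif κ z, ← hf, integral_comp_measure]
      · rfl
      · exact integrable_of_continuous (by fun_prop)
    simp [this, (normConst_pos (D := D) hκ).ne']
  · exact Integrable.of_bound hmeas.aestronglyMeasurable _ (ae_of_all _ hbound)

lemma integrable_pairDensity [NeZero D] {κ : ℝ} (hκ : 0 ≤ κ) (f : Encoder X D)
    (μ : Measure (X × X)) [IsFiniteMeasure μ] : Integrable (pairDensity κ f) μ :=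
  Integrable.of_bound (measurable_pairDensity κ f).aestronglyMeasurable
    (Real.exp κ / Real.exp (-κ)) (ae_of_all _ fun p => by
      rw [Real.norm_of_nonneg (pairDensity_pos hκ f p).le]; exact (pairDensity_mem_Icc hκ f p).2)

lemma integral_pairDensity [NeZero D] {κ : ℝ} (hκ : 0 ≤ κ) {P : Measure X}
    [IsProbabilityMeasure P] {f : Encoder X D} (hf : UniformMarginal P f) :
    ∫ p, pairDensity κ f p ∂(P.prod P) = 1 := by
  rw [integral_prod _ (integrable_pairDensity hκ f _)]
  simp [integral_pairDensity_right hκ hf]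

lemma lintegral_posKernel [NeZero D] (κ : ℝ) (z : Latent D)
    (G : Latent D → ENNReal) :
    ∫⁻ w, G w ∂(posKernel D κ z) =
      ∫⁻ w, ENNReal.ofReal (Real.exp (κ * dot z w) / normConst D κ) * G w ∂(unif D) := by
  have h0 : surface D Set.univ ≠ 0 := by
    simpa [Measure.measure_univ_eq_zero] using NeZero.ne (surface D)
  have hA : 0 < (surface D).real Set.univ := ENNReal.toReal_pos h0 (measure_ne_top _ _)
  change ∫⁻ w, G w ∂(vMF z κ) = _
  rw [vMF, lintegral_tilted, unif, lintegral_smul_measure, smul_eq_mul,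
    ← lintegral_const_mul' _ _ (ENNReal.inv_ne_top.2 h0)]
  congr with w
  rw [← mul_assoc]
  congr 1
  rw [← integral_exp_dot_unif κ z, integral_unif, ← ofReal_measureReal,
    ← ENNReal.ofReal_inv_of_pos hA, ← ENNReal.ofReal_mul (inv_pos.2 hA).le]
  congr 1
  field_simp

/-- Bayes' rule in integrated form: latent-then-observation sampling is traded for
observation-then-posterior sampling. -/
lemma HasPosterior.lintegral_eq [NeZero D] {g : Kernel (Latent D) X} [IsMarkovKernel g]
    {θ : Encoder X D} (hθ : HasPosterior g θ) {G : Latent D → X → ENNReal}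
    (hG : Measurable (Function.uncurry G)) :
    ∫⁻ z, ∫⁻ x, G z x ∂(g z) ∂(unif D) = ∫⁻ x, ∫⁻ z, G z x ∂(θ.kernel x) ∂(obsLaw g) := by
  have h1 := Measure.lintegral_compProd (μ := unif D) (κ := g) hG
  have h2 := Measure.lintegral_compProd (μ := obsLaw g) (κ := θ.kernel)
    (f := fun p : X × Latent D => G p.2 p.1) (hG.comp measurable_swap)
  rw [← hθ, lintegral_map (f := fun p : X × Latent D => G p.2 p.1)
    (hG.comp measurable_swap) measurable_swap] at h2
  exact h1.symm.trans h2

lemma ofReal_pairDensity [NeZero D] {κ : ℝ} (hκ : 0 ≤ κ) (f : Encoder X D) (x y : X) :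
    ENNReal.ofReal (pairDensity κ f (x, y)) =
      ∫⁻ z, ∫⁻ w, ENNReal.ofReal (Real.exp (κ * dot z w) / normConst D κ)
        ∂(f.kernel y) ∂(f.kernel x) := by
  have hC := normConst_pos (D := D) hκ
  simp only [pairDensity, pairing]
  rw [← integral_div, ofReal_integral_eq_lintegral_ofReal]
  · congr with z
    rw [← integral_div, ofReal_integral_eq_lintegral_ofReal]
    · rfl
    · exact integrable_of_continuous (by fun_prop)
    · exact ae_of_all _ fun w => by positivity
  · exact (integrable_of_continuous (continuous_integral_exp_dot κ (f.params y))).div_const _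
  · exact ae_of_all _ fun z => div_nonneg (integral_nonneg fun _ => (Real.exp_pos _).le) hC.le

/-- If the true posteriors are von Mises-Fisher, then positive pairs have the density which the
true parameters predict. -/
lemma pairLaw_eq_withDensity [NeZero D] {κ : ℝ} (hκ : 0 ≤ κ) {g : Kernel (Latent D) X}
    [IsMarkovKernel g] {θ : Encoder X D} (hθ : HasPosterior g θ) :
    pairLaw κ g = ((obsLaw g).prod (obsLaw g)).withDensity
      (fun p => ENNReal.ofReal (pairDensity κ θ p)) := by
  refine Measure.ext_of_lintegral _ fun F hF => ?_
  set ρ : Latent D → Latent D → ENNReal :=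
    fun z w => ENNReal.ofReal (Real.exp (κ * dot z w) / normConst D κ) with hρ
  have hρm : Measurable (fun r : Latent D × Latent D => ρ r.1 r.2) := by
    have : Continuous (fun r : Latent D × Latent D => Real.exp (κ * dot r.1 r.2)) := by fun_prop
    exact (this.measurable.div_const _).ennreal_ofReal
  have hρz : ∀ z, Measurable (ρ z) := fun z => hρm.of_uncurry_left
  have hinner : Measurable (fun r : (Latent D × X) × Latent D =>
      ∫⁻ y, ρ r.1.1 r.2 * F (r.1.2, y) ∂(g r.2)) := by
    refine Measurable.lintegral_kernel_prod_right' (κ := g.comap Prod.snd measurable_snd)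
      (f := fun q : ((Latent D × X) × Latent D) × X => ρ q.1.1.1 q.1.2 * F (q.1.1.2, q.2)) ?_
    exact (hρm.comp (by fun_prop : Measurable fun q : ((Latent D × X) × Latent D) × X =>
      (q.1.1.1, q.1.2))).mul (hF.comp (by fun_prop))
  calc ∫⁻ p, F p ∂(pairLaw κ g)
      = ∫⁻ z, ∫⁻ w, ∫⁻ x, ∫⁻ y, F (x, y) ∂(g w) ∂(g z) ∂(posKernel D κ z) ∂(unif D) := by
        rw [pairLaw, Measure.lintegral_bind (Kernel.aemeasurable _) hF.aemeasurable,
          Measure.lintegral_compProd hF.lintegral_kernel]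
        simp_rw [Kernel.lintegral_parallelComp (hg := hF)]
    _ = ∫⁻ z, ∫⁻ w, ∫⁻ x, ∫⁻ y, ρ z w * F (x, y) ∂(g w) ∂(g z) ∂(unif D) ∂(unif D) := by
        refine lintegral_congr fun z => ?_
        rw [lintegral_posKernel]
        refine lintegral_congr fun w => ?_
        rw [← lintegral_const_mul' _ _ ENNReal.ofReal_ne_top]
        refine lintegral_congr fun x => ?_
        rw [← lintegral_const_mul' _ _ ENNReal.ofReal_ne_top]
    -- The exchange puts each latent next to its own observation, so that Bayes' rule applies first
    -- to `(z, x)` and then to `(w, y)`.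
    _ = ∫⁻ z, ∫⁻ x, ∫⁻ w, ∫⁻ y, ρ z w * F (x, y) ∂(g w) ∂(unif D) ∂(g z) ∂(unif D) := by
        refine lintegral_congr fun z => ?_
        rw [lintegral_lintegral_swap]
        exact (hinner.comp (by fun_prop : Measurable fun q : Latent D × X =>
          ((z, q.2), q.1))).aemeasurable
    _ = ∫⁻ x, ∫⁻ z, ∫⁻ w, ∫⁻ y, ρ z w * F (x, y) ∂(g w) ∂(unif D) ∂(θ.kernel x) ∂(obsLaw g) :=
        hθ.lintegral_eq (Measurable.lintegral_prod_right hinner)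
    _ = ∫⁻ x, ∫⁻ z, ∫⁻ y, ∫⁻ w, ρ z w * F (x, y) ∂(θ.kernel y) ∂(obsLaw g) ∂(θ.kernel x)
          ∂(obsLaw g) := by
        refine lintegral_congr fun x => lintegral_congr fun z => ?_
        refine hθ.lintegral_eq (G := fun w y => ρ z w * F (x, y)) ?_
        exact (hρm.comp (by fun_prop : Measurable fun q : Latent D × X => (z, q.1))).mul
          (hF.comp (by fun_prop : Measurable fun q : Latent D × X => (x, q.2)))
    _ = ∫⁻ x, ∫⁻ y, ∫⁻ z, ∫⁻ w, ρ z w * F (x, y) ∂(θ.kernel y) ∂(θ.kernel x) ∂(obsLaw g)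
          ∂(obsLaw g) := by
        refine lintegral_congr fun x => ?_
        rw [lintegral_lintegral_swap]
        refine (Measurable.lintegral_kernel_prod_right'
          (κ := θ.kernel.comap (fun q : Latent D × X => q.2) measurable_snd)
          (f := fun q : (Latent D × X) × Latent D => ρ q.1.1 q.2 * F (x, q.1.2)) ?_).aemeasurable
        exact (hρm.comp (by fun_prop : Measurable fun q : (Latent D × X) × Latent D =>
          (q.1.1, q.2))).mul (hF.comp (by fun_prop))
    _ = ∫⁻ x, ∫⁻ y, ENNReal.ofReal (pairDensity κ θ (x, y)) * F (x, y) ∂(obsLaw g)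
          ∂(obsLaw g) := by
        refine lintegral_congr fun x => lintegral_congr fun y => ?_
        rw [ofReal_pairDensity hκ, ← lintegral_mul_const]
        · refine lintegral_congr fun z => ?_
          rw [← lintegral_mul_const]
          exact hρz z
        · exact Measurable.lintegral_prod_right' (f := fun r : Latent D × Latent D => ρ r.1 r.2) hρm
    _ = _ := by
        rw [lintegral_withDensity_eq_lintegral_mul _ (by fun_prop) hF, lintegral_prod]
        · rfl
        · exact ((by fun_prop : Measurable _).mul hF).aemeasurable

/-- Gibbs' inequality for densities which are bounded and bounded away from zero. -/
lemma gibbs {Y : Type*} [MeasurableSpace Y] {μ : Measure Y} [IsFiniteMeasure μ] {u v : Y → ℝ}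
    (hu : Measurable u) (hv : Measurable v) {a b : ℝ} (ha : 0 < a)
    (hub : ∀ y, u y ∈ Set.Icc a b) (hvb : ∀ y, v y ∈ Set.Icc a b)
    (h : ∫ y, u y ∂μ = ∫ y, v y ∂μ) :
    ∫ y, u y * -Real.log (u y) ∂μ ≤ ∫ y, u y * -Real.log (v y) ∂μ ∧
      (∫ y, u y * -Real.log (v y) ∂μ ≤ ∫ y, u y * -Real.log (u y) ∂μ → v =ᵐ[μ] u) := by
  have hlog : ∀ {t}, t ∈ Set.Icc a b → |Real.log t| ≤ max |Real.log a| |Real.log b| := by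
    intro t ht
    exact abs_le_max_abs_abs (Real.log_le_log ha ht.1) (Real.log_le_log (ha.trans_le ht.1) ht.2)
  have hint : ∀ w : Y → ℝ, Measurable w → (∀ y, w y ∈ Set.Icc a b) →
      Integrable (fun y => u y * -Real.log (w y)) μ := by
    intro w hw hwb
    refine Integrable.of_bound (by fun_prop) (b * max |Real.log a| |Real.log b|)
      (ae_of_all _ fun y => ?_)
    rw [norm_mul, norm_neg, Real.norm_eq_abs, Real.norm_eq_abs,
      abs_of_pos (ha.trans_le (hub y).1)]
    exact mul_le_mul (hub y).2 (hlog (hwb y)) (abs_nonneg _)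
      (ha.le.trans ((hub y).1.trans (hub y).2))
  have hint' : ∀ w : Y → ℝ, Measurable w → (∀ y, w y ∈ Set.Icc a b) → Integrable w μ := by
    intro w hw hwb
    refine Integrable.of_bound (by fun_prop) b (ae_of_all _ fun y => ?_)
    rw [Real.norm_of_nonneg (ha.le.trans (hwb y).1)]
    exact (hwb y).2
  -- The added term `v - u` has integral zero and makes the integrand `u * (t - 1 - log t)` with `t
  -- = v / u`, which is nonnegative pointwise and vanishes only at `t = 1`.
  set d : Y → ℝ := fun y => u y * -Real.log (v y) - u y * -Real.log (u y) + (v y - u y) with hd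
  have hdi : Integrable d μ :=
    ((hint v hv hvb).sub (hint u hu hub)).add ((hint' v hv hvb).sub (hint' u hu hub))
  have hde : ∀ y, d y = u y * (v y / u y - 1 - Real.log (v y / u y)) := by
    intro y
    have hu0 := ha.trans_le (hub y).1
    have hv0 := ha.trans_le (hvb y).1
    rw [hd, Real.log_div hv0.ne' hu0.ne']
    field_simp
    ring
  have hd0 : ∀ y, 0 ≤ d y := by
    intro y
    have hu0 := ha.trans_le (hub y).1
    have hv0 := ha.trans_le (hvb y).1
    rw [hde]
    exact mul_nonneg hu0.le (by linarith [Real.log_le_sub_one_of_pos (div_pos hv0 hu0)])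
  have hdint : ∫ y, d y ∂μ =
      ∫ y, u y * -Real.log (v y) ∂μ - ∫ y, u y * -Real.log (u y) ∂μ := by
    have := integral_add ((hint v hv hvb).sub (hint u hu hub))
      ((hint' v hv hvb).sub (hint' u hu hub))
    refine this.trans ?_
    simp only [Pi.sub_apply]
    rw [integral_sub (hint v hv hvb) (hint u hu hub),
      integral_sub (hint' v hv hvb) (hint' u hu hub), h]
    ring
  have hnn : 0 ≤ ∫ y, d y ∂μ := integral_nonneg hd0
  refine ⟨by linarith, fun hle => ?_⟩
  have hz : ∫ y, d y ∂μ = 0 := le_antisymm (by linarith) hnn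
  filter_upwards [(integral_eq_zero_iff_of_nonneg hd0 hdi).1 hz] with y hy
  have hu0 := ha.trans_le (hub y).1
  have hv0 := ha.trans_le (hvb y).1
  by_contra hne
  have hlt := Real.log_lt_sub_one_of_pos (div_pos hv0 hu0)
    (fun e => hne ((div_eq_one_iff_eq hu0.ne').1 e))
  have : 0 < d y := by rw [hde]; exact mul_pos hu0 (by linarith)
  exact this.ne' hy

/-- A closed condition on pairs which holds almost everywhere holds on the support. -/
lemma mem_of_ae_prod_of_mem_support {Y : Type*} [TopologicalSpace Y] [MeasurableSpace Y]
    {μ : Measure Y} [SFinite μ] {S : Set (Y × Y)} (hS : IsClosed S)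
    (h : ∀ᵐ p ∂(μ.prod μ), p ∈ S) {s t : Y} (hs : s ∈ μ.support) (ht : t ∈ μ.support) :
    (s, t) ∈ S := by
  by_contra hst
  obtain ⟨U, hU, V, hV, hUV⟩ := mem_nhds_prod_iff.1 (hS.isOpen_compl.mem_nhds hst)
  have h0 : (μ.prod μ) (U ×ˢ V) = 0 := measure_mono_null hUV h
  rw [Measure.prod_prod, mul_eq_zero] at h0
  rw [Measure.mem_support_iff_forall] at hs ht
  exact h0.elim (hs U hU).ne' (ht V hV).ne'

/-- The limit of the loss in terms of the predicted density of positive pairs. -/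
def crossEntropy (κ : ℝ) (g : Kernel (Latent D) X) (f : Encoder X D) : ℝ :=
  ∫ p, -Real.log (pairDensity κ f p) ∂(pairLaw κ g)

lemma crossEntropy_eq [NeZero D] {κ : ℝ} (hκ : 0 ≤ κ) {g : Kernel (Latent D) X}
    [IsMarkovKernel g] {θ : Encoder X D} (hθ : HasPosterior g θ) (f : Encoder X D) :
    crossEntropy κ g f = ∫ p, pairDensity κ θ p * -Real.log (pairDensity κ f p)
      ∂((obsLaw g).prod (obsLaw g)) := by
  rw [crossEntropy, pairLaw_eq_withDensity hκ hθ,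
    integral_withDensity_eq_integral_toReal_smul (by fun_prop)
      (ae_of_all _ fun _ => ENNReal.ofReal_lt_top)]
  congr with p
  rw [ENNReal.toReal_ofReal (pairDensity_pos hκ θ p).le, smul_eq_mul]

end PairDensity

/-! ### Independent draws from a kernel -/

section ProductKernel

variable {ι Y Z : Type*} [Fintype ι] [MeasurableSpace Y] [MeasurableSpace Z]

/-- The kernel which draws the coordinates independently from the laws `η (y i)`. -/
def piKernel (ι : Type*) [Fintype ι] (η : Kernel Y Z) [IsMarkovKernel η] :
    Kernel (ι → Y) (ι → Z) where
  toFun y := Measure.pi fun i => η (y i)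
  measurable' := by
    refine Measurable.measure_of_isPiSystem_of_isProbabilityMeasure generateFrom_pi.symm
      isPiSystem_pi ?_
    rintro _ ⟨t, ht, rfl⟩
    simp_rw [Measure.pi_pi]
    exact Finset.measurable_prod _ fun i _ =>
      (η.measurable_coe (ht i (Set.mem_univ i))).comp (measurable_pi_apply i)

lemma piKernel_apply (η : Kernel Y Z) [IsMarkovKernel η] (y : ι → Y) :
    piKernel ι η y = Measure.pi fun i => η (y i) := rfl

instance (η : Kernel Y Z) [IsMarkovKernel η] : IsMarkovKernel (piKernel ι η) :=
  ⟨fun y => inferInstanceAs (IsProbabilityMeasure (Measure.pi fun i => η (y i)))⟩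

/-- On boxes this is Fubini for a product of functions of separate coordinates. It turns negatives
predicted from i.i.d. observations into i.i.d. draws from the aggregate marginal. -/
lemma piKernel_comp_pi (η : Kernel Y Z) [IsMarkovKernel η] (μ : Measure Y)
    [IsProbabilityMeasure μ] :
    piKernel ι η ∘ₘ Measure.pi (fun _ => μ) = Measure.pi (fun _ : ι => η ∘ₘ μ) := by
  refine (Measure.pi_eq fun s hs => ?_).symm
  have hreal : ∀ i, (η ∘ₘ μ).real (s i) = ∫ y, (η y).real (s i) ∂μ := by
    intro i
    have hm := η.measurable_coe (hs i)
    rw [measureReal_def, Measure.bind_apply (hs i) η.aemeasurable]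
    simp_rw [measureReal_def]
    rw [integral_toReal hm.aemeasurable (ae_of_all _ fun y => measure_lt_top _ _)]
  rw [← ENNReal.toReal_eq_toReal_iff' (measure_ne_top _ _)
    (ENNReal.prod_ne_top fun i _ => measure_ne_top _ _), ENNReal.toReal_prod]
  have hms : MeasurableSet (Set.univ.pi s) := MeasurableSet.univ_pi hs
  rw [Measure.bind_apply hms (Kernel.aemeasurable _), ← integral_toReal
    ((piKernel ι η).measurable_coe hms).aemeasurable (ae_of_all _ fun y => measure_lt_top _ _)]
  simp_rw [piKernel_apply, Measure.pi_pi, ENNReal.toReal_prod]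
  change ∫ y : ι → Y, ∏ i, (η (y i)).real (s i) ∂_ = ∏ i, (η ∘ₘ μ).real (s i)
  rw [integral_fintype_prod_eq_prod (f := fun i y => (η y).real (s i))]
  simp_rw [hreal]

end ProductKernel

/-! ### A quantitative law of large numbers -/

section Averages

variable {Y : Type*} [MeasurableSpace Y] {μ : Measure Y} [IsProbabilityMeasure μ]

/-- The variances of independent coordinates add up, and each is at most `b ^ 2`. -/
lemma integral_sq_sum_pi_le {ψ : Y → ℝ} (hψ : Measurable ψ) {b : ℝ} (hb : ∀ y, |ψ y| ≤ b)
    (h0 : ∫ y, ψ y ∂μ = 0) (M : ℕ) :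
    ∫ ω, (∑ m, ψ (ω m)) ^ 2 ∂(Measure.pi fun _ : Fin M => μ) ≤ M * b ^ 2 := by
  have hL : MemLp ψ 2 μ := MemLp.of_bound hψ.aestronglyMeasurable b (ae_of_all _ hb)
  have hvar := variance_sum_pi (ι := Fin M) (μ := fun _ => μ) (X := fun _ => ψ) fun _ => hL
  have hmean : ∫ ω, (∑ m, fun ω : Fin M → Y => ψ (ω m)) ω ∂(Measure.pi fun _ : Fin M => μ) = 0 := by
    simp only [Finset.sum_apply]
    rw [integral_finsetSum]
    · refine Finset.sum_eq_zero fun m _ => ?_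
      rw [integral_comp_eval (μ := fun _ => μ) (f := ψ) hψ.aestronglyMeasurable, h0]
    · intro m _
      exact Integrable.of_bound (by fun_prop : Measurable _).aestronglyMeasurable
          b (ae_of_all _ fun ω => hb (ω m))
  rw [variance_of_integral_eq_zero (by fun_prop) hmean] at hvar
  have hle : Var[ψ; μ] ≤ b ^ 2 := by
    rw [variance_of_integral_eq_zero hψ.aemeasurable h0]
    refine integral_le_of_forall_le ?_ fun y => sq_le_sq' (neg_le_of_abs_le (hb y))
      (le_of_abs_le (hb y))
    exact hL.integrable_sq
  simp only [Finset.sum_apply] at hvar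
  rw [hvar]
  simp only [Finset.sum_const, Finset.card_univ, Fintype.card_fin, nsmul_eq_mul]
  gcongr

/-- The average of `M` independent bounded centred variables is of order `1 / √M` in mean. -/
lemma integral_abs_average_le {ψ : Y → ℝ} (hψ : Measurable ψ) {b : ℝ} (hb : ∀ y, |ψ y| ≤ b)
    (h0 : ∫ y, ψ y ∂μ = 0) {M : ℕ} (hM : 0 < M) :
    ∫ ω, |1 / (M : ℝ) * ∑ m, ψ (ω m)| ∂(Measure.pi fun _ : Fin M => μ) ≤
      (1 + b ^ 2) / (2 * √M) := by
  have hM' : (0 : ℝ) < M := Nat.cast_pos.2 hM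
  have hs : 0 < √(M : ℝ) := Real.sqrt_pos.2 hM'
  have hss : √(M : ℝ) ^ 2 = M := Real.sq_sqrt hM'.le
  have hsum : ∀ ω : Fin M → Y, |∑ m, ψ (ω m)| ≤ M * b := fun ω =>
    (Finset.abs_sum_le_sum_abs _ _).trans
      ((Finset.sum_le_sum fun m _ => hb (ω m)).trans (by simp))
  have hi2 : Integrable (fun ω : Fin M → Y => (∑ m, ψ (ω m)) ^ 2)
      (Measure.pi fun _ : Fin M => μ) := by
    refine Integrable.of_bound (by fun_prop : Measurable _).aestronglyMeasurable
          ((M * b) ^ 2) (ae_of_all _ fun ω => ?_)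
    rw [norm_pow, Real.norm_eq_abs]
    exact pow_le_pow_left₀ (abs_nonneg _) (hsum ω) 2
  -- Completing the square bounds the absolute value by its square, with weights chosen so that both
  -- terms have order `1 / √M` in mean.
  have hpt : ∀ ω : Fin M → Y, |1 / (M : ℝ) * ∑ m, ψ (ω m)| ≤
      1 / (2 * √M) + 1 / (2 * M * √M) * (∑ m, ψ (ω m)) ^ 2 := by
    intro ω
    set t := ∑ m, ψ (ω m)
    rw [abs_mul, abs_of_pos (by positivity : (0 : ℝ) < 1 / M), ← sq_abs t]
    have : 1 / (2 * √(M : ℝ)) + 1 / (2 * M * √M) * |t| ^ 2 - 1 / (M : ℝ) * |t| =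
        1 / (2 * √(M : ℝ)) * (1 - |t| / √(M : ℝ)) ^ 2 := by
      generalize √(M : ℝ) = s at hs hss ⊢
      rw [← hss]
      field_simp
      ring
    have h2 : 0 ≤ 1 / (2 * √(M : ℝ)) * (1 - |t| / √(M : ℝ)) ^ 2 := by positivity
    linarith
  calc ∫ ω, |1 / (M : ℝ) * ∑ m, ψ (ω m)| ∂(Measure.pi fun _ : Fin M => μ)
      ≤ ∫ ω, (1 / (2 * √M) + 1 / (2 * M * √M) * (∑ m, ψ (ω m)) ^ 2)
          ∂(Measure.pi fun _ : Fin M => μ) := by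
        refine integral_mono ?_ ((integrable_const _).add (hi2.const_mul _)) hpt
        refine Integrable.of_bound (by fun_prop : Measurable _).aestronglyMeasurable
          (1 / M * (M * b)) (ae_of_all _ fun ω => ?_)
        rw [norm_abs_eq_norm, norm_mul, Real.norm_eq_abs, Real.norm_eq_abs,
          abs_of_pos (by positivity : (0 : ℝ) < 1 / M)]
        exact mul_le_mul_of_nonneg_left (hsum ω) (by positivity)
    _ = 1 / (2 * √M) + 1 / (2 * M * √M) * ∫ ω, (∑ m, ψ (ω m)) ^ 2
          ∂(Measure.pi fun _ : Fin M => μ) := by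
        rw [integral_add (integrable_const _) (hi2.const_mul _), integral_const_mul]
        simp
    _ ≤ 1 / (2 * √M) + 1 / (2 * M * √M) * (M * b ^ 2) := by
        gcongr
        exact integral_sq_sum_pi_le hψ hb h0 M
    _ = (1 + b ^ 2) / (2 * √M) := by
        field_simp

end Averages

/-- On `[δ, ∞)` the logarithm is Lipschitz with constant `1 / δ`, by `log t ≤ t - 1` at the
quotient. -/
lemma abs_log_sub_log_le {s t δ : ℝ} (hδ : 0 < δ) (hs : δ ≤ s) (ht : δ ≤ t) :
    |Real.log s - Real.log t| ≤ |s - t| / δ := by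
  have key : ∀ {u v : ℝ}, δ ≤ u → δ ≤ v → Real.log u - Real.log v ≤ |u - v| / δ := by
    intro u v hu hv
    have hu0 := hδ.trans_le hu
    have hv0 := hδ.trans_le hv
    rw [← Real.log_div hu0.ne' hv0.ne']
    calc Real.log (u / v) ≤ u / v - 1 := Real.log_le_sub_one_of_pos (div_pos hu0 hv0)
      _ = (u - v) / v := by field_simp
      _ ≤ |u - v| / v := by gcongr; exact le_abs_self _
      _ ≤ |u - v| / δ := by gcongr
  rw [abs_le']
  exact ⟨key hs ht, by rw [neg_sub, abs_sub_comm]; exact key ht hs⟩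

lemma continuous_integral_compact {Y Z : Type*} [TopologicalSpace Y] [FirstCountableTopology Y]
    [LocallyCompactSpace Y] [TopologicalSpace Z] [CompactSpace Z] [MeasurableSpace Z]
    [OpensMeasurableSpace Z] (μ : Measure Z) [IsFiniteMeasure μ] {G : Y → Z → ℝ}
    (hG : Continuous (Function.uncurry G)) : Continuous (fun y => ∫ z, G y z ∂μ) := by
  have := continuous_parametric_integral_of_continuous (μ := μ) hG isCompact_univ
  simpa only [Measure.restrict_univ] using this

/-! ### Convergence of the loss to the cross-entropy -/

section Limit

variable {X : Type*} [MeasurableSpace X] {D : ℕ}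

/-- The average of the centred values of the negatives. -/
def negDeviation (κ : ℝ) (M : ℕ) (z : Latent D) (zn : Fin M → Latent D) : ℝ :=
  1 / (M : ℝ) * ∑ m, (Real.exp (κ * dot z (zn m)) - normConst D κ)

@[fun_prop]
lemma continuous_negDeviation {Y : Type*} [TopologicalSpace Y] (κ : ℝ) (M : ℕ)
    {z : Y → Latent D} {zn : Y → Fin M → Latent D} (hz : Continuous z) (hzn : Continuous zn) :
    Continuous (fun y => negDeviation κ M (z y) (zn y)) := by
  unfold negDeviation; fun_prop

section Bounds

variable [NeZero D] {κ : ℝ} (hκ : 0 ≤ κ)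
include hκ

lemma abs_exp_dot_sub_le (z w : Latent D) :
    |Real.exp (κ * dot z w) - normConst D κ| ≤ Real.exp κ := by
  have h1 := exp_dot_le_exp hκ z w
  have h2 := normConst_le_exp (D := D) hκ
  have h3 := normConst_pos (D := D) hκ
  have h4 := Real.exp_pos (κ * dot z w)
  rw [abs_le]
  constructor <;> linarith

lemma abs_negDeviation_le {M : ℕ} (hM : 0 < M) (z : Latent D) (zn : Fin M → Latent D) :
    |negDeviation κ M z zn| ≤ Real.exp κ := by
  have hM' : (0 : ℝ) < M := Nat.cast_pos.2 hM
  rw [negDeviation, abs_mul, abs_of_pos (by positivity : (0 : ℝ) < 1 / M)]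
  have : |∑ m, (Real.exp (κ * dot z (zn m)) - normConst D κ)| ≤ M * Real.exp κ :=
    (Finset.abs_sum_le_sum_abs _ _).trans
      ((Finset.sum_le_sum fun m _ => abs_exp_dot_sub_le hκ z (zn m)).trans (by simp))
  calc _ ≤ 1 / (M : ℝ) * (M * Real.exp κ) := by gcongr
    _ = Real.exp κ := by field_simp

omit [NeZero D] in
-- The bounds do not depend on `M`; the factor 2 absorbs the positive term. For `M = 0` the
-- denominator is 0, hence the assumption `0 < M` throughout.
lemma denominator_mem_Icc {M : ℕ} (hM : 0 < M) (z zp : Latent D) (zn : Fin M → Latent D) :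
    (1 / (M : ℝ)) * Real.exp (κ * dot z zp) + (1 / (M : ℝ)) * ∑ m, Real.exp (κ * dot z (zn m)) ∈
      Set.Icc (Real.exp (-κ)) (2 * Real.exp κ) := by
  have hM' : (1 : ℝ) ≤ M := by exact_mod_cast hM
  have h0 : (0 : ℝ) < M := by linarith
  have hl : M * Real.exp (-κ) ≤ ∑ m, Real.exp (κ * dot z (zn m)) := by
    simpa using Finset.sum_le_sum (s := Finset.univ)
      fun m _ => exp_neg_le_exp_dot hκ z (zn m)
  have hu : ∑ m, Real.exp (κ * dot z (zn m)) ≤ M * Real.exp κ := by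
    simpa using Finset.sum_le_sum (s := Finset.univ)
      fun m _ => exp_dot_le_exp hκ z (zn m)
  constructor
  · have : 0 ≤ 1 / (M : ℝ) * Real.exp (κ * dot z zp) := by positivity
    calc Real.exp (-κ) = 1 / (M : ℝ) * (M * Real.exp (-κ)) := by field_simp
      _ ≤ 1 / (M : ℝ) * ∑ m, Real.exp (κ * dot z (zn m)) := by gcongr
      _ ≤ _ := by linarith
  · have h1 : 1 / (M : ℝ) * Real.exp (κ * dot z zp) ≤ 1 * Real.exp κ := by
      have := exp_dot_le_exp hκ z zp
      have := (div_le_one h0).2 hM'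
      gcongr
    calc _ ≤ 1 * Real.exp κ + 1 / (M : ℝ) * (M * Real.exp κ) := by gcongr
      _ = 2 * Real.exp κ := by field_simp; ring

omit [NeZero D] in
lemma infoNCERatio_mem_Icc {M : ℕ} (hM : 0 < M) (z zp : Latent D) (zn : Fin M → Latent D) :
    infoNCERatio κ M z zp zn ∈
      Set.Icc (Real.exp (-κ) / (2 * Real.exp κ)) (Real.exp κ / Real.exp (-κ)) := by
  obtain ⟨hl, hu⟩ := denominator_mem_Icc hκ hM z zp zn
  exact ⟨div_le_div₀ (Real.exp_pos _).le (exp_neg_le_exp_dot hκ z zp)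
    ((Real.exp_pos _).trans_le hl) hu, div_le_div₀ (Real.exp_pos _).le (exp_dot_le_exp hκ z zp)
    (Real.exp_pos _) hl⟩

/-- The denominator differs from `normConst` by the positive term, of order `1 / M`, and by the
deviation of the negatives. Both denominators are at least `exp (-κ)`, whence the square. -/
lemma abs_infoNCERatio_sub_le {M : ℕ} (hM : 0 < M) (z zp : Latent D) (zn : Fin M → Latent D) :
    |infoNCERatio κ M z zp zn - Real.exp (κ * dot z zp) / normConst D κ| ≤
      Real.exp κ / Real.exp (-κ) ^ 2 * (Real.exp κ / M + |negDeviation κ M z zn|) := by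
  have hB := (denominator_mem_Icc hκ hM z zp zn).1
  have hC := exp_neg_le_normConst (D := D) hκ
  have hM' : (0 : ℝ) < M := Nat.cast_pos.2 hM
  rw [infoNCERatio]
  set e := Real.exp (κ * dot z zp)
  set B := (1 / (M : ℝ)) * e + (1 / (M : ℝ)) * ∑ m, Real.exp (κ * dot z (zn m))
  have he0 : 0 < e := Real.exp_pos _
  have he : e ≤ Real.exp κ := exp_dot_le_exp hκ z zp
  have ha : 0 < Real.exp (-κ) := Real.exp_pos _
  have hB0 : 0 < B := ha.trans_le hB
  have hC0 : 0 < normConst D κ := ha.trans_le hC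
  have hBC : B - normConst D κ = 1 / M * e + negDeviation κ M z zn := by
    have : B = normConst D κ + (1 / M * e + negDeviation κ M z zn) := by
      simp only [B, negDeviation, Finset.sum_sub_distrib, Finset.sum_const, Finset.card_univ,
        Fintype.card_fin, nsmul_eq_mul]
      field_simp
      ring
    rw [this]; ring
  have hdiff : e / B - e / normConst D κ = e / (B * normConst D κ) * (normConst D κ - B) := by
    field_simp
  rw [hdiff, abs_mul, abs_of_pos (by positivity), abs_sub_comm, hBC]
  have h1 : |1 / (M : ℝ) * e + negDeviation κ M z zn| ≤
      Real.exp κ / M + |negDeviation κ M z zn| := by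
    refine (abs_add_le _ _).trans ?_
    rw [abs_of_pos (by positivity), one_div_mul_eq_div]
    gcongr
  have h2 : e / (B * normConst D κ) ≤ Real.exp κ / Real.exp (-κ) ^ 2 := by
    rw [sq]; gcongr
  gcongr

lemma integral_abs_negDeviation_le {M : ℕ} (hM : 0 < M) (z : Latent D) :
    ∫ zn, |negDeviation κ M z zn| ∂(Measure.pi fun _ : Fin M => unif D) ≤
      (1 + Real.exp κ ^ 2) / (2 * √M) := by
  refine integral_abs_average_le (ψ := fun w => Real.exp (κ * dot z w) - normConst D κ)
    (by have : Continuous fun w => Real.exp (κ * dot z w) - normConst D κ := by fun_prop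
        exact this.measurable) (abs_exp_dot_sub_le hκ z) ?_ hM
  rw [integral_sub (integrable_of_continuous (by fun_prop)) (integrable_const _),
    integral_exp_dot_unif]
  simp

omit [NeZero D] in
lemma continuous_infoNCERatio {M : ℕ} (hM : 0 < M) {Y : Type*} [TopologicalSpace Y]
    {z zp : Y → Latent D} {zn : Y → Fin M → Latent D} (hz : Continuous z) (hzp : Continuous zp)
    (hzn : Continuous zn) : Continuous (fun y => infoNCERatio κ M (z y) (zp y) (zn y)) := by
  unfold infoNCERatio
  refine Continuous.div (by fun_prop) (by fun_prop) fun y => ?_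
  exact ((Real.exp_pos _).trans_le (denominator_mem_Icc hκ hM (z y) (zp y) (zn y)).1).ne'

end Bounds

/-- The expected InfoNCE fraction of a training tuple. -/
def expectedRatio (κ : ℝ) (M : ℕ) (f : Encoder X D) (x xp : X) (xn : Fin M → X) : ℝ :=
  ∫ z, ∫ zp, ∫ zn, infoNCERatio κ M z zp zn
    ∂(Measure.pi fun m => f.kernel (xn m)) ∂(f.kernel xp) ∂(f.kernel x)

lemma tupleLoss_eq (κ : ℝ) (M : ℕ) (f : Encoder X D) (x xp : X) (xn : Fin M → X) :
    tupleLoss κ M f x xp xn = -Real.log (expectedRatio κ M f x xp xn) := rfl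

section Estimates

variable [NeZero D] {κ : ℝ} (hκ : 0 ≤ κ) {M : ℕ} (hM : 0 < M) (f : Encoder X D)
include hκ hM

lemma continuous_integral_infoNCERatio (xn : Fin M → X) :
    Continuous (fun r : Latent D × Latent D => ∫ zn, infoNCERatio κ M r.1 r.2 zn
      ∂(Measure.pi fun m => f.kernel (xn m))) :=
  continuous_integral_compact (G := fun (r : Latent D × Latent D) zn =>
    infoNCERatio κ M r.1 r.2 zn) _ (continuous_infoNCERatio hκ hM (by fun_prop) (by fun_prop)
      (by fun_prop))

lemma continuous_integral_integral_infoNCERatio (xp : X) (xn : Fin M → X) :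
    Continuous (fun z : Latent D => ∫ zp, ∫ zn, infoNCERatio κ M z zp zn
      ∂(Measure.pi fun m => f.kernel (xn m)) ∂(f.kernel xp)) :=
  continuous_integral_compact (G := fun z zp => ∫ zn, infoNCERatio κ M z zp zn
    ∂(Measure.pi fun m => f.kernel (xn m))) _ (continuous_integral_infoNCERatio hκ hM f xn)

lemma expectedRatio_mem_Icc (x xp : X) (xn : Fin M → X) :
    expectedRatio κ M f x xp xn ∈
      Set.Icc (Real.exp (-κ) / (2 * Real.exp κ)) (Real.exp κ / Real.exp (-κ)) := by
  have h1 : ∀ z zp, Integrable (fun zn => infoNCERatio κ M z zp zn)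
      (Measure.pi fun m => f.kernel (xn m)) := fun z zp => integrable_of_continuous
    (continuous_infoNCERatio hκ hM (by fun_prop) (by fun_prop) (by fun_prop))
  have h2 : ∀ z, Integrable (fun zp => ∫ zn, infoNCERatio κ M z zp zn
      ∂(Measure.pi fun m => f.kernel (xn m))) (f.kernel xp) := fun z => integrable_of_continuous
    ((continuous_integral_infoNCERatio hκ hM f xn).comp (by fun_prop : Continuous fun zp => (z, zp)))
  have h3 := integrable_of_continuous (μ := f.kernel x)
    (continuous_integral_integral_infoNCERatio hκ hM f xp xn)
  exact ⟨le_integral_of_forall_le h3 fun z => le_integral_of_forall_le (h2 z) fun zp =>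
      le_integral_of_forall_le (h1 z zp) fun zn => (infoNCERatio_mem_Icc hκ hM z zp zn).1,
    integral_le_of_forall_le h3 fun z => integral_le_of_forall_le (h2 z) fun zp =>
      integral_le_of_forall_le (h1 z zp) fun zn => (infoNCERatio_mem_Icc hκ hM z zp zn).2⟩

/-- The pointwise estimate is integrated over the negatives, the positive and the reference in turn;
its bound does not involve the positive latent. -/
lemma abs_expectedRatio_sub_le (x xp : X) (xn : Fin M → X) :
    |expectedRatio κ M f x xp xn - pairDensity κ f (x, xp)| ≤
      Real.exp κ / Real.exp (-κ) ^ 2 * (Real.exp κ / M +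
        ∫ z, ∫ zn, |negDeviation κ M z zn| ∂(piKernel (Fin M) f.kernel xn) ∂(f.kernel x)) := by
  set c := Real.exp κ / Real.exp (-κ) ^ 2
  set π := Measure.pi fun m => f.kernel (xn m) with hπ
  have hpd : pairDensity κ f (x, xp) =
      ∫ z, ∫ zp, Real.exp (κ * dot z zp) / normConst D κ ∂(f.kernel xp) ∂(f.kernel x) := by
    simp_rw [integral_div]; rfl
  have hdevc : Continuous (fun z : Latent D => ∫ zn, |negDeviation κ M z zn| ∂π) :=
    continuous_integral_compact (G := fun z zn => |negDeviation κ M z zn|) _ (by fun_prop)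
  have hec : Continuous (fun z : Latent D =>
      ∫ zp, Real.exp (κ * dot z zp) / normConst D κ ∂(f.kernel xp)) :=
    continuous_integral_compact (G := fun z zp => Real.exp (κ * dot z zp) / normConst D κ) _
      (by fun_prop)
  have h1 : ∀ z zp, |∫ zn, infoNCERatio κ M z zp zn ∂π - Real.exp (κ * dot z zp) / normConst D κ|
      ≤ c * (Real.exp κ / M + ∫ zn, |negDeviation κ M z zn| ∂π) := by
    intro z zp
    have hi : Integrable (fun zn => infoNCERatio κ M z zp zn) π := integrable_of_continuous
      (continuous_infoNCERatio hκ hM (by fun_prop) (by fun_prop) (by fun_prop))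
    have hi2 : Integrable (fun zn => |negDeviation κ M z zn|) π :=
      integrable_of_continuous (by fun_prop)
    calc _ = |∫ zn, (infoNCERatio κ M z zp zn - Real.exp (κ * dot z zp) / normConst D κ) ∂π| := by
          rw [integral_sub hi (integrable_const _)]; simp
      _ ≤ ∫ zn, |infoNCERatio κ M z zp zn - Real.exp (κ * dot z zp) / normConst D κ| ∂π :=
          abs_integral_le_integral_abs
      _ ≤ ∫ zn, c * (Real.exp κ / M + |negDeviation κ M z zn|) ∂π :=
          integral_mono (hi.sub (integrable_const _)).abs
            (((integrable_const _).add hi2).const_mul _) (abs_infoNCERatio_sub_le hκ hM z zp)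
      _ = _ := by
          rw [integral_const_mul, integral_add (integrable_const _) hi2]; simp
  have h2 : ∀ z, |∫ zp, ∫ zn, infoNCERatio κ M z zp zn ∂π ∂(f.kernel xp) -
      ∫ zp, Real.exp (κ * dot z zp) / normConst D κ ∂(f.kernel xp)|
      ≤ c * (Real.exp κ / M + ∫ zn, |negDeviation κ M z zn| ∂π) := by
    intro z
    have hi : Integrable (fun zp => ∫ zn, infoNCERatio κ M z zp zn ∂π) (f.kernel xp) :=
      integrable_of_continuous ((continuous_integral_infoNCERatio hκ hM f xn).comp
        (by fun_prop : Continuous fun zp => (z, zp)))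
    rw [← integral_sub hi (integrable_of_continuous (by fun_prop))]
    have := norm_integral_le_of_norm_le_const (μ := f.kernel xp)
      (ae_of_all _ fun zp => (Real.norm_eq_abs _).trans_le (h1 z zp))
    simpa using this
  have h3 := integrable_of_continuous (μ := f.kernel x)
    (continuous_integral_integral_infoNCERatio hκ hM f xp xn)
  have h4 := integrable_of_continuous (μ := f.kernel x) hec
  have h5 := integrable_of_continuous (μ := f.kernel x) hdevc
  rw [hpd, expectedRatio, ← integral_sub h3 h4]
  calc _ ≤ ∫ z, |∫ zp, ∫ zn, infoNCERatio κ M z zp zn ∂π ∂(f.kernel xp) -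
          ∫ zp, Real.exp (κ * dot z zp) / normConst D κ ∂(f.kernel xp)| ∂(f.kernel x) :=
        abs_integral_le_integral_abs
    _ ≤ ∫ z, c * (Real.exp κ / M + ∫ zn, |negDeviation κ M z zn| ∂π) ∂(f.kernel x) :=
        integral_mono (h3.sub h4).abs (((integrable_const _).add h5).const_mul _) h2
    _ = _ := by
        rw [integral_const_mul, integral_add (integrable_const _) h5]
        simp [hπ, piKernel_apply]

lemma stronglyMeasurable_expectedRatio :
    StronglyMeasurable (fun q : (X × X) × (Fin M → X) =>
      expectedRatio κ M f q.1.1 q.1.2 q.2) := by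
  have h0 : StronglyMeasurable (fun r : ((((X × X) × (Fin M → X)) × Latent D) × Latent D) × (Fin M → Latent D) =>
      infoNCERatio κ M r.1.1.2 r.1.2 r.2) := by
    have hc : Continuous (fun r : (Latent D × Latent D) × (Fin M → Latent D) =>
        infoNCERatio κ M r.1.1 r.1.2 r.2) :=
      continuous_infoNCERatio hκ hM (by fun_prop) (by fun_prop) (by fun_prop)
    exact (hc.measurable.comp (by fun_prop : Measurable fun
      r : ((((X × X) × (Fin M → X)) × Latent D) × Latent D) × (Fin M → Latent D) =>
        ((r.1.1.2, r.1.2), r.2))).stronglyMeasurable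
  have h1 := h0.integral_kernel_prod_right' (κ := (piKernel (Fin M) f.kernel).comap
    (fun r : (((X × X) × (Fin M → X)) × Latent D) × Latent D => r.1.1.2) (by fun_prop))
  have h2 := h1.integral_kernel_prod_right' (κ := f.kernel.comap
    (fun r : ((X × X) × (Fin M → X)) × Latent D => r.1.1.2) (by fun_prop))
  exact h2.integral_kernel_prod_right' (κ := f.kernel.comap (fun r : (X × X) × (Fin M → X) => r.1.1) (by fun_prop))

lemma abs_tupleLoss_le (x xp : X) (xn : Fin M → X) :
    |tupleLoss κ M f x xp xn| ≤ max |Real.log (Real.exp (-κ) / (2 * Real.exp κ))|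
      |Real.log (Real.exp κ / Real.exp (-κ))| := by
  obtain ⟨hl, hu⟩ := expectedRatio_mem_Icc hκ hM f x xp xn
  have h0 : 0 < Real.exp (-κ) / (2 * Real.exp κ) := by positivity
  rw [tupleLoss_eq, abs_neg]
  exact abs_le_max_abs_abs (Real.log_le_log h0 hl) (Real.log_le_log (h0.trans_le hl) hu)

lemma stronglyMeasurable_tupleLoss :
    StronglyMeasurable (fun q : (X × X) × (Fin M → X) => tupleLoss κ M f q.1.1 q.1.2 q.2) :=
  (stronglyMeasurable_expectedRatio hκ hM f).measurable.log.neg.stronglyMeasurable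

/-- The constant `exp (-κ) / (2 * exp κ)` bounds both the expected ratio and the predicted density
from below, so the Lipschitz estimate for the logarithm applies. -/
lemma abs_tupleLoss_sub_le (x xp : X) (xn : Fin M → X) :
    |tupleLoss κ M f x xp xn - -Real.log (pairDensity κ f (x, xp))| ≤
      Real.exp κ / Real.exp (-κ) ^ 2 / (Real.exp (-κ) / (2 * Real.exp κ)) * (Real.exp κ / M +
        ∫ z, ∫ zn, |negDeviation κ M z zn| ∂(piKernel (Fin M) f.kernel xn) ∂(f.kernel x)) := by
  have h0 : 0 < Real.exp (-κ) / (2 * Real.exp κ) := by positivity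
  have hpd : Real.exp (-κ) / (2 * Real.exp κ) ≤ pairDensity κ f (x, xp) := by
    refine le_trans ?_ (pairDensity_mem_Icc hκ f (x, xp)).1
    gcongr
    linarith [Real.exp_pos κ]
  rw [tupleLoss_eq, neg_sub_neg, abs_sub_comm]
  refine (abs_log_sub_log_le h0 (expectedRatio_mem_Icc hκ hM f x xp xn).1 hpd).trans ?_
  rw [div_mul_eq_mul_div]
  gcongr
  exact abs_expectedRatio_sub_le hκ hM f x xp xn

lemma integrable_integral_abs_negDeviation (μ : Measure ((Fin M → X) × Latent D))
    [IsFiniteMeasure μ] :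
    Integrable (fun r : (Fin M → X) × Latent D =>
      ∫ zn, |negDeviation κ M r.2 zn| ∂(piKernel (Fin M) f.kernel r.1)) μ := by
  have hc : Continuous (fun r : Latent D × (Fin M → Latent D) => |negDeviation κ M r.1 r.2|) := by
    fun_prop
  have hm : StronglyMeasurable (fun r : (Fin M → X) × Latent D =>
      ∫ zn, |negDeviation κ M r.2 zn| ∂(piKernel (Fin M) f.kernel r.1)) :=
    StronglyMeasurable.integral_kernel_prod_right'
      (f := fun r : ((Fin M → X) × Latent D) × (Fin M → Latent D) => |negDeviation κ M r.1.2 r.2|)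
      (κ := (piKernel (Fin M) f.kernel).comap (fun r : (Fin M → X) × Latent D => r.1)
        measurable_fst)
      (hc.measurable.comp (by fun_prop : Measurable fun
        r : ((Fin M → X) × Latent D) × (Fin M → Latent D) => (r.1.2, r.2))).stronglyMeasurable
  refine Integrable.of_bound hm.aestronglyMeasurable (Real.exp κ) (ae_of_all _ fun r => ?_)
  rw [Real.norm_of_nonneg (integral_nonneg fun _ => abs_nonneg _)]
  exact integral_le_of_forall_le (integrable_of_continuous (by fun_prop))
    (abs_negDeviation_le hκ hM r.2)

/-- Averaging the deviation over the negative observations yields uniform negative latents, if the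
aggregate marginal of the encoder is uniform. -/
lemma integral_integral_negDeviation_le {P : Measure X} [IsProbabilityMeasure P]
    (hf : UniformMarginal P f) (x : X) :
    ∫ xn, ∫ z, ∫ zn, |negDeviation κ M z zn| ∂(piKernel (Fin M) f.kernel xn) ∂(f.kernel x)
      ∂(Measure.pi fun _ => P) ≤ (1 + Real.exp κ ^ 2) / (2 * √M) := by
  have hint := integrable_integral_abs_negDeviation hκ hM f
    ((Measure.pi fun _ => P).prod (f.kernel x))
  -- With the reference latent fixed, averaging over the negative observations comes first and
  -- produces uniform independent negatives.
  rw [integral_integral_swap hint]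
  have hz : ∀ z : Latent D, ∫ xn, ∫ zn, |negDeviation κ M z zn|
      ∂(piKernel (Fin M) f.kernel xn) ∂(Measure.pi fun _ => P) ≤
        (1 + Real.exp κ ^ 2) / (2 * √M) := by
    intro z
    rw [← integral_comp_measure (integrable_of_continuous (by fun_prop)), piKernel_comp_pi, hf]
    exact integral_abs_negDeviation_le hκ hM z
  exact integral_le_of_forall_le hint.integral_prod_right hz

lemma abs_loss_sub_crossEntropy_le {g : Kernel (Latent D) X} [IsMarkovKernel g]
    (hf : UniformMarginal (obsLaw g) f) :
    |loss κ g M f - crossEntropy κ g f| ≤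
      Real.exp κ / Real.exp (-κ) ^ 2 / (Real.exp (-κ) / (2 * Real.exp κ)) *
        (Real.exp κ / M + (1 + Real.exp κ ^ 2) / (2 * √M)) := by
  set c := Real.exp κ / Real.exp (-κ) ^ 2 / (Real.exp (-κ) / (2 * Real.exp κ))
  have hc : 0 ≤ c := by positivity
  set π := Measure.pi fun _ : Fin M => obsLaw g with hπ
  set A : X → (Fin M → X) → ℝ := fun x xn =>
    ∫ z, ∫ zn, |negDeviation κ M z zn| ∂(piKernel (Fin M) f.kernel xn) ∂(f.kernel x) with hA
  have hsm := stronglyMeasurable_tupleLoss hκ hM f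
  have hbd := abs_tupleLoss_le hκ hM f
  have hi : ∀ p : X × X, Integrable (fun xn => tupleLoss κ M f p.1 p.2 xn) π := fun p =>
    Integrable.of_bound (hsm.comp_measurable (by fun_prop :
      Measurable fun xn : Fin M → X => (p, xn))).aestronglyMeasurable _
      (ae_of_all _ fun xn => hbd p.1 p.2 xn)
  have hAi : ∀ x, Integrable (A x) π := fun x =>
    (integrable_integral_abs_negDeviation hκ hM f (π.prod (f.kernel x))).integral_prod_left
  have hpt : ∀ p : X × X, |∫ xn, tupleLoss κ M f p.1 p.2 xn ∂π - -Real.log (pairDensity κ f p)| ≤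
      c * (Real.exp κ / M + (1 + Real.exp κ ^ 2) / (2 * √M)) := by
    intro p
    calc _ = |∫ xn, (tupleLoss κ M f p.1 p.2 xn - -Real.log (pairDensity κ f p)) ∂π| := by
          rw [integral_sub (hi p) (integrable_const _)]; simp
      _ ≤ ∫ xn, |tupleLoss κ M f p.1 p.2 xn - -Real.log (pairDensity κ f p)| ∂π :=
          abs_integral_le_integral_abs
      _ ≤ ∫ xn, c * (Real.exp κ / M + A p.1 xn) ∂π :=
          integral_mono ((hi p).sub (integrable_const _)).abs
            (((integrable_const _).add (hAi p.1)).const_mul _)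
            fun xn => abs_tupleLoss_sub_le hκ hM f p.1 p.2 xn
      _ = c * (Real.exp κ / M + ∫ xn, A p.1 xn ∂π) := by
          rw [integral_const_mul, integral_add (integrable_const _) (hAi p.1)]; simp
      _ ≤ _ := by
          gcongr
          exact integral_integral_negDeviation_le hκ hM f hf p.1
  have hli : Integrable (fun p : X × X => -Real.log (pairDensity κ f p)) (pairLaw κ g) := by
    refine Integrable.of_bound (by fun_prop : Measurable _).aestronglyMeasurable
      (max |Real.log (Real.exp (-κ) / Real.exp κ)| |Real.log (Real.exp κ / Real.exp (-κ))|)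
      (ae_of_all _ fun p => ?_)
    obtain ⟨hl, hu⟩ := pairDensity_mem_Icc hκ f p
    rw [norm_neg, Real.norm_eq_abs]
    exact abs_le_max_abs_abs (Real.log_le_log (by positivity) hl)
      (Real.log_le_log (pairDensity_pos hκ f p) hu)
  have hoi : Integrable (fun p : X × X => ∫ xn, tupleLoss κ M f p.1 p.2 xn ∂π) (pairLaw κ g) := by
    refine Integrable.of_bound (StronglyMeasurable.integral_prod_right' hsm).aestronglyMeasurable
      (max |Real.log (Real.exp (-κ) / (2 * Real.exp κ))| |Real.log (Real.exp κ / Real.exp (-κ))|)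
      (ae_of_all _ fun p => ?_)
    have := norm_integral_le_of_norm_le_const (μ := π) (ae_of_all _ fun xn =>
      (Real.norm_eq_abs _).trans_le (hbd p.1 p.2 xn))
    simpa using this
  rw [loss, crossEntropy, ← integral_sub hoi hli]
  have := norm_integral_le_of_norm_le_const (μ := pairLaw κ g) (ae_of_all _ fun p =>
    (Real.norm_eq_abs _).trans_le (hpt p))
  simpa using this

end Estimates

lemma tendsto_loss [NeZero D] {κ : ℝ} (hκ : 0 ≤ κ) {g : Kernel (Latent D) X} [IsMarkovKernel g]
    {f : Encoder X D} (hf : UniformMarginal (obsLaw g) f) :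
    Tendsto (fun M : ℕ => loss κ g M f) atTop (𝓝 (crossEntropy κ g f)) := by
  rw [tendsto_iff_norm_sub_tendsto_zero]
  refine squeeze_zero' (Eventually.of_forall fun _ => norm_nonneg _)
    ((eventually_gt_atTop 0).mono fun M hM => abs_loss_sub_crossEntropy_le hκ hM f hf) ?_
  have h1 : Tendsto (fun M : ℕ => Real.exp κ / (M : ℝ)) atTop (𝓝 0) :=
    tendsto_const_div_atTop_nhds_zero_nat _
  have h2 : Tendsto (fun M : ℕ => (1 + Real.exp κ ^ 2) / (2 * √(M : ℝ))) atTop (𝓝 0) :=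
    Tendsto.div_atTop tendsto_const_nhds ((Real.tendsto_sqrt_atTop.comp
      tendsto_natCast_atTop_atTop).const_mul_atTop two_pos)
  simpa using (h1.add h2).const_mul
    (Real.exp κ / Real.exp (-κ) ^ 2 / (Real.exp (-κ) / (2 * Real.exp κ)))

lemma limitLoss_eq [NeZero D] {κ : ℝ} (hκ : 0 ≤ κ) {g : Kernel (Latent D) X} [IsMarkovKernel g]
    {f : Encoder X D} (hf : UniformMarginal (obsLaw g) f) :
    limitLoss κ g f = crossEntropy κ g f :=
  (tendsto_loss hκ hf).limUnder_eq

end Limit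

/-! ### Recovering the parameters from the pair density -/

section Identifiability

variable {X : Type*} [MeasurableSpace X] {D : ℕ}

/-- Two encoders predicting the same density of positive pairs on a set of observations agree there
up to one orthogonal matrix. -/
lemma exists_agreesAt_of_pairDensity_eq [NeZero D] {κ : ℝ} (hκ : 0 < κ) (θ f : Encoder X D)
    (S : Set X) (h : ∀ x ∈ S, ∀ y ∈ S,
      pairing κ (f.params x) (f.params y) = pairing κ (θ.params x) (θ.params y)) :
    ∃ R ∈ Matrix.orthogonalGroup (Fin D) ℝ, ∀ x ∈ S, AgreesAt R θ f x := by
  have hconc : ∀ x ∈ S, f.conc x = θ.conc x := fun x hx =>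
    conc_eq_of_pairing_self_eq hκ (f.conc_pos x) (θ.conc_pos x) (h x hx x hx)
  have hdot : ∀ x ∈ S, ∀ y ∈ S, dot (θ.mean x) (θ.mean y) = dot (f.mean x) (f.mean y) := by
    intro x hx y hy
    have := h x hx y hy
    simp only [Encoder.params, hconc x hx, hconc y hy] at this
    exact (dot_eq_of_pairing_eq hκ (θ.conc_pos x) (θ.conc_pos y) this).symm
  obtain ⟨R, hR, hRS⟩ := exists_orthogonal_of_inner_eq
    (fun x : S => (θ.mean x : EuclideanSpace ℝ (Fin D)))
    (fun x : S => (f.mean x : EuclideanSpace ℝ (Fin D)))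
    fun x y => hdot x x.2 y y.2
  exact ⟨R, hR, fun x hx => ⟨hconc x hx, hRS ⟨x, hx⟩⟩⟩

/-- The parameters of two encoders at an observation. -/
def jointParams (θ f : Encoder X D) (x : X) : (Latent D × ℝ) × (Latent D × ℝ) :=
  (f.params x, θ.params x)

@[fun_prop]
lemma measurable_jointParams (θ f : Encoder X D) : Measurable (jointParams θ f) :=
  f.measurable_params.prodMk θ.measurable_params

lemma continuous_pairing_comp [NeZero D] {Y : Type*} [TopologicalSpace Y] (κ : ℝ)
    {p q : Y → Latent D × ℝ} (hp : Continuous p) (hq : Continuous q) :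
    Continuous (fun y => pairing κ (p y) (q y)) :=
  Continuous.comp (g := fun r : (Latent D × ℝ) × (Latent D × ℝ) => pairing κ r.1 r.2)
    (f := fun y => (p y, q y)) (continuous_pairing κ) (hp.prodMk hq)

attribute [local irreducible] pairing

variable (D) in
/-- The pairs of joint parameters for which both encoders predict the same density. -/
def agreementSet (κ : ℝ) :
    Set (((Latent D × ℝ) × (Latent D × ℝ)) × ((Latent D × ℝ) × (Latent D × ℝ))) :=
  {r | pairing κ r.1.1 r.2.1 = pairing κ r.1.2 r.2.2}

lemma isClosed_agreementSet [NeZero D] (κ : ℝ) : IsClosed (agreementSet D κ) := by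
  unfold agreementSet
  refine isClosed_eq ?_ ?_
  · exact continuous_pairing_comp κ (by fun_prop) (by fun_prop)
  · exact continuous_pairing_comp κ (by fun_prop) (by fun_prop)

/-- The almost everywhere equality is pushed forward to the parameter space, where `pairing` is
continuous whatever the encoders are, and so extends to the support. Taking `x = y` is allowed,
which yields the diagonal values. -/
lemma pairing_eq_of_mem_support [NeZero D] {κ : ℝ} (hκ : 0 ≤ κ) {P : Measure X}
    [IsProbabilityMeasure P] {θ f : Encoder X D}
    (h : pairDensity κ f =ᵐ[P.prod P] pairDensity κ θ) {x y : X}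
    (hx : jointParams θ f x ∈ (P.map (jointParams θ f)).support)
    (hy : jointParams θ f y ∈ (P.map (jointParams θ f)).support) :
    pairing κ (f.params x) (f.params y) = pairing κ (θ.params x) (θ.params y) := by
  have hT := measurable_jointParams θ f
  have hSc := isClosed_agreementSet (D := D) κ
  have hP : ∀ᵐ p ∂(P.prod P), Prod.map (jointParams θ f) (jointParams θ f) p ∈
      agreementSet D κ := by
    filter_upwards [h] with p hp
    rw [pairDensity, pairDensity, div_left_inj' (normConst_pos (D := D) hκ).ne'] at hp
    exact hp
  have hmap : ∀ᵐ p ∂((P.map (jointParams θ f)).prod (P.map (jointParams θ f))),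
      p ∈ agreementSet D κ := by
    rw [Measure.map_prod_map _ _ hT hT]
    exact (ae_map_iff (hT.prodMap hT).aemeasurable hSc.measurableSet).2 hP
  exact mem_of_ae_prod_of_mem_support hSc hmap hx hy

end Identifiability

end MCInfoNCE

end

open MCInfoNCE
theorem theorem1 {X : Type*} [MeasurableSpace X] [TopologicalSpace X] {D : ℕ} (hD : 0 < D)
    (κpos : ℝ) (hκpos : 0 < κpos)
    (g : Kernel (Latent D) X) [IsMarkovKernel g]
    (θ : Encoder X D) (hθ : HasPosterior g θ)
    (𝓕 : Set (Encoder X D)) (hunif : ∀ f ∈ 𝓕, UniformMarginal (obsLaw g) f) (hmem : θ ∈ 𝓕) :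
    (∀ f ∈ 𝓕, Tendsto (fun M : ℕ => loss κpos g M f) atTop (𝓝 (limitLoss κpos g f))) ∧
    IsMinOn (limitLoss κpos g) 𝓕 θ ∧
    ∀ f ∈ 𝓕, IsMinOn (limitLoss κpos g) 𝓕 f →
      ∃ R ∈ Matrix.orthogonalGroup (Fin D) ℝ,
        (∀ᵐ x ∂(obsLaw g), AgreesAt R θ f x) ∧
        (∀ x, 0 < obsLaw g {x} → AgreesAt R θ f x) ∧
        (∀ x ∈ (obsLaw g).support,
          ContinuousAt θ.mean x → ContinuousAt θ.conc x →
          ContinuousAt f.mean x → ContinuousAt f.conc x → AgreesAt R θ f x) := by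
  have : NeZero D := ⟨hD.ne'⟩
  have hκ := hκpos.le
  have hlim : ∀ f ∈ 𝓕, limitLoss κpos g f = crossEntropy κpos g f :=
    fun f hf => limitLoss_eq hκ (hunif f hf)
  have hgibbs := fun f (hf : f ∈ 𝓕) => gibbs (μ := (obsLaw g).prod (obsLaw g))
    (measurable_pairDensity κpos θ) (measurable_pairDensity κpos f) (by positivity)
    (pairDensity_mem_Icc hκ θ) (pairDensity_mem_Icc hκ f)
    ((integral_pairDensity hκ (hunif θ hmem)).trans (integral_pairDensity hκ (hunif f hf)).symm)
  simp only [← crossEntropy_eq hκ hθ] at hgibbs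
  refine ⟨fun f hf => ?_, fun f hf => ?_, fun f hf hmin => ?_⟩
  · rw [hlim f hf]
    exact tendsto_loss hκ (hunif f hf)
  · change limitLoss κpos g θ ≤ limitLoss κpos g f
    rw [hlim f hf, hlim θ hmem]
    exact (hgibbs f hf).1
  · have hle : limitLoss κpos g f ≤ limitLoss κpos g θ := hmin hmem
    rw [hlim f hf, hlim θ hmem] at hle
    have hae := (hgibbs f hf).2 hle
    have hT := measurable_jointParams θ f
    set ρ := (obsLaw g).map (jointParams θ f)
    -- A single matrix is fixed for all observations whose joint parameters lie in the support of
    -- `ρ`; the three claims only have to place `x` in this set.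
    obtain ⟨R, hR, hRS⟩ := exists_agreesAt_of_pairDensity_eq hκpos θ f
      (jointParams θ f ⁻¹' ρ.support) fun x hx y hy => pairing_eq_of_mem_support hκ hae hx hy
    have hS : ∀ᵐ x ∂(obsLaw g), jointParams θ f x ∈ ρ.support :=
      ae_of_ae_map hT.aemeasurable Measure.support_mem_ae
    refine ⟨R, hR, hS.mono hRS, fun x hx => hRS x ?_, fun x hx h1 h2 h3 h4 => hRS x ?_⟩
    -- The exceptional set is null, so it contains no atom.
    · by_contra hn
      exact hx.ne' (measure_mono_null (Set.singleton_subset_iff.2 hn) hS)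
    -- By continuity, a neighbourhood of the joint parameters at `x` pulls back to a neighbourhood
    -- of `x`, which has positive measure.
    · have hc : ContinuousAt (jointParams θ f) x := (h3.prodMk h4).prodMk (h1.prodMk h2)
      rw [Set.mem_preimage, Measure.mem_support_iff_forall]
      intro U hU
      rw [Measure.mem_support_iff_forall] at hx
      exact (hx _ (hc hU)).trans_le (Measure.le_map_apply hT.aemeasurable U)
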